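/- Let $R$ be a Dedekind domain whose field of fractions $K$ has characteristic $0$. All group schemes are commutative; a finite flat group scheme over a base is a commutative group scheme whose structure morphism is finite and flat. Let $G$ be a finite flat group scheme over $K$. A prolongation of $G$ to $R$ is a finite flat group scheme $\mathcal{G}$ over $R$ together with an isomorphism of group schemes $\mathcal{G}\times_{\operatorname{Spec} R}\operatorname{Spec} K\cong G$. A morphism between prolongations of $G$ is said to extend an endomorphism $\alpha$ of $G$ if its base change to $K$ is $\alpha$, under the given identifications of the generic fibres with $G$. For two prolongations write $G_1\ge G_2$ if there is a morphism of group schemes $G_1\to G_2$ over $R$ extending the identity of $G$. Suppose that $G$ has a prolongation to $R$. Then: (0) The relation $\ge$ is a partial order on the prolongations of $G$, considered up to isomorphisms extending the identity of $G$: it is reflexive and transitive, and if $G_1\ge G_2$ and $G_2\ge G_1$ then there is an isomorphism $G_1\cong G_2$ extending the identity of $G$. (i) There are prolongations $G^+$ and $G^-$ of $G$ to $R$ which are respectively a maximum and a minimum for $\ge$, i.e. $G^+\ge \mathcal{G}\ge G^-$ for every prolongation $\mathcal{G}$ of $G$ to $R$. (ii) Every automorphism of $G$ extends to an automorphism of $G^+$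 and to an automorphism of $G^-$, and in each case this is the only endomorphism extending it. -/

import Mathlib

open CategoryTheory AlgebraicGeometry

universe u

/-- The category of (commutative) group schemes over `S`: commutative group objects in the
category of `S`-schemes, with homomorphisms of group objects. -/
abbrev GroupScheme (S : Scheme.{u}) := CommGrp (Over S)

/-- A finite flat group scheme over `S`: the structure morphism to `S` is finite and flat. -/
structure GroupScheme.IsFiniteFlat {S : Scheme.{u}} (G : GroupScheme S) : Prop where
  finite : IsFinite G.X.hom
  flat : Flat G.X.hom

/-- Base change of group schemes from `R` to `K`, that is, the functor
`G ↦ G ×_{Spec R} Spec K`. -/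
noncomputable def GroupScheme.baseChange (R K : Type u) [CommRing R] [CommRing K] [Algebra R K] :
    GroupScheme (Spec (.of R)) ⥤ GroupScheme (Spec (.of K)) :=
  (Over.pullback (Spec.map (CommRingCat.ofHom (algebraMap R K)))).mapCommGrp

/-- A prolongation to `R` of a group scheme `G` over `K`: a finite flat group scheme over `R`
together with an identification of its base change to `K` with `G`. -/
structure Prolongation (R : Type u) {K : Type u} [CommRing R] [CommRing K] [Algebra R K]
    (G : GroupScheme (Spec (.of K))) where
  /-- The group scheme over `R`. -/
  obj : GroupScheme (Spec (.of R))
  isFiniteFlat : obj.IsFiniteFlat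
  /-- The identification of the generic fibre with `G`. -/
  iso : (GroupScheme.baseChange R K).obj obj ≅ G

namespace Prolongation

variable {R K : Type u} [CommRing R] [CommRing K] [Algebra R K] {G : GroupScheme (Spec (.of K))}

/-- A morphism `f` between two prolongations of `G` extends (prolongs) the endomorphism `α` of `G`
if its base change to `K` is `α`, under the given identifications of the generic fibres with `G`. -/
def Extends {P Q : Prolongation R G} (f : P.obj ⟶ Q.obj) (α : G ⟶ G) : Prop :=
  (GroupScheme.baseChange R K).map f ≫ Q.iso.hom = P.iso.hom ≫ α

/-- `P ≥ Q` if there is a morphism of group schemes `P ⟶ Q` extending the identity of `G`. -/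
instance : LE (Prolongation R G) where
  le Q P := ∃ f : P.obj ⟶ Q.obj, Extends f (𝟙 G)

instance : Preorder (Prolongation R G) where
  le_refl P := ⟨𝟙 P.obj, by simp [Extends]⟩
  le_trans := by
    rintro P Q T ⟨f, hf⟩ ⟨g, hg⟩
    refine ⟨g ≫ f, ?_⟩
    simp only [Extends, Category.comp_id] at hf hg ⊢
    rw [Functor.map_comp, Category.assoc, hf, hg]

end Prolongation

/-!
The coordinate ring of `G` is a finite-dimensional commutative and cocommutative Hopf algebra `A`
over `K`. Sending a prolongation to the image in `A` of its coordinate ring identifies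
prolongations, up to isomorphisms extending the identity of `G`, with Hopf orders in `A`, that is,
with subalgebras over `R` that are lattices stable under the structure maps. Under this
correspondence `P ≤ Q` means that the order of `P` is contained in that of `Q`
(`Prolongation.Model.le_iff`, `Prolongation.Model.exists_order_eq`), so what is needed is a
greatest and a least Hopf order.

The compositum of two Hopf orders is a Hopf order, so the Hopf orders are upwards directed. They
are bounded above: if `C₀ ⊆ C` are orders, then `C` is contained in the dual of `C₀` for the trace
form of `A`, which is a finitely generated module because that form is nondegenerate. As `R` is
Noetherian, a directed and bounded nonempty family of lattices has a greatest element
(`Submodule.IsLattice.exists_greatest_order`). Two Hopf orders also contain a common Hopf order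
(`Subalgebra.IsHopfOrder.exists_inf`), so for the least Hopf order the same argument applies to the
dual lattices, which are orders in the convolution algebra dual to `A`
(`Subalgebra.IsHopfOrder.exists_isGreatest`, `Subalgebra.IsHopfOrder.exists_isLeast`).

The nondegeneracy of both trace forms in characteristic zero has an elementary proof. There is an
integral `c` in `A` representing the trace of the dual algebra, and its counit is the dimension `n`
of `A` (`HopfAlgebra.exists_integral`). The identity `n a = ∑ c₁ tr(S(a) c₂)` then recovers `a`
from the functional `tr(S(a) ·)` (`HopfAlgebra.finrank_smul_eq`), and it also shows that a
functional `φ` with `∑ φ(c₁) c₂ = 0` vanishes, which is the nondegeneracy on the dual side.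

Finite flat group schemes over `R` have coordinate rings that embed in their base changes to `K`,
so a morphism extending a given endomorphism of `G` is unique (`Prolongation.Extends.ext`). This
gives the antisymmetry. It also gives the extension of automorphisms: if `P` is maximal or minimal,
comparing `P` with the prolongation obtained from it by composing the identification of the generic
fibre with an automorphism of `G` shows that this automorphism and its inverse extend to `P`, and
the two extensions are inverse to each other by uniqueness.
-/

/-! ### Integrals and trace forms of finite-dimensional commutative Hopf algebras -/

section FieldHopf
open TensorProduct Coalgebra HopfAlgebra Module

variable {K A : Type*} [Field K] [CommRing A] [HopfAlgebra K A]

namespace HopfAlgebra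

variable (K) in
/-- With Sweedler indices, `∑ (S(a₁) ⊗ 1) Δ(a₂) = 1 ⊗ a`. -/
theorem one_tmul_eq_map_comul (a : A) :
    LinearMap.mul' K (A ⊗[K] A) (TensorProduct.map
      ((TensorProduct.mk K A A).flip 1 ∘ₗ antipode K) (comul (R := K)) (comul (R := K) a)) =
        (1 : A) ⊗ₜ[K] a := by
  have key : LinearMap.mul' K (A ⊗[K] A) ∘ₗ TensorProduct.map
      ((TensorProduct.mk K A A).flip 1 ∘ₗ antipode K) LinearMap.id =
      (LinearMap.mul' K A ∘ₗ (antipode K).rTensor A).rTensor A ∘ₗ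
        (TensorProduct.assoc K A A A).symm.toLinearMap := by
    ext x y z; simp
  have h1 : TensorProduct.map ((TensorProduct.mk K A A).flip 1 ∘ₗ antipode K) (comul (R := K))
      (comul (R := K) a) = TensorProduct.map ((TensorProduct.mk K A A).flip 1 ∘ₗ antipode K)
        LinearMap.id ((comul (R := K)).lTensor A (comul (R := K) a)) := by
    rw [LinearMap.lTensor, TensorProduct.map_map, LinearMap.id_comp, LinearMap.comp_id]
  rw [h1, ← LinearMap.comp_apply, key, LinearMap.comp_apply, LinearEquiv.coe_coe,
    coassoc_symm_apply, ← LinearMap.comp_apply, ← LinearMap.rTensor_comp, LinearMap.comp_assoc,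
    mul_antipode_rTensor_comul, LinearMap.rTensor_comp, LinearMap.comp_apply,
    rTensor_counit_comul]
  simp

variable (K) in
/-- With Sweedler indices, `∑ Δ(a₁) (1 ⊗ S(a₂)) = a ⊗ 1`. -/
theorem tmul_one_eq_map_comul (a : A) :
    LinearMap.mul' K (A ⊗[K] A) (TensorProduct.map (comul (R := K))
      (TensorProduct.mk K A A 1 ∘ₗ antipode K) (comul (R := K) a)) = a ⊗ₜ[K] (1 : A) := by
  have key : LinearMap.mul' K (A ⊗[K] A) ∘ₗ TensorProduct.map LinearMap.id
      (TensorProduct.mk K A A 1 ∘ₗ antipode K) =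
      (LinearMap.mul' K A ∘ₗ (antipode K).lTensor A).lTensor A ∘ₗ
        (TensorProduct.assoc K A A A).toLinearMap := by
    ext x y z; simp
  have h1 : TensorProduct.map (comul (R := K)) (TensorProduct.mk K A A 1 ∘ₗ antipode K)
      (comul (R := K) a) = TensorProduct.map LinearMap.id (TensorProduct.mk K A A 1 ∘ₗ antipode K)
        ((comul (R := K)).rTensor A (comul (R := K) a)) := by
    rw [LinearMap.rTensor, TensorProduct.map_map, LinearMap.id_comp, LinearMap.comp_id]
  rw [h1, ← LinearMap.comp_apply, key, LinearMap.comp_apply, LinearEquiv.coe_coe,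
    coassoc_apply, ← LinearMap.comp_apply, ← LinearMap.lTensor_comp, LinearMap.comp_assoc,
    mul_antipode_lTensor_comul, LinearMap.lTensor_comp, LinearMap.comp_apply,
    lTensor_counit_comul]
  simp

/-- Multiplying `Δ(c)`, for an integral `c`, by `a` on the left factor is the same as multiplying
it by `S(a)` on the right factor. -/
theorem tmul_mul_comul_of_integral {c : A} (hc : ∀ x : A, x * c = counit (R := K) x • c) (a : A) :
    (a ⊗ₜ[K] (1 : A)) * comul (R := K) c = ((1 : A) ⊗ₜ[K] antipode K a) * comul (R := K) c := by
  let r := ℛ K a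
  rw [← tmul_one_eq_map_comul, ← r.eq]
  simp only [map_sum, TensorProduct.map_tmul, LinearMap.mul'_apply, Finset.sum_mul]
  have : ∀ i, comul (R := K) (r.left i) * (TensorProduct.mk K A A 1 ∘ₗ antipode K) (r.right i) *
      comul (R := K) c = ((1 : A) ⊗ₜ[K] antipode K (counit (R := K) (r.left i) • r.right i)) *
        comul (R := K) c := by
    intro i
    rw [mul_comm (comul (R := K) (r.left i)), mul_assoc, ← Bialgebra.comul_mul, hc]
    simp
  simp_rw [this]
  rw [← Finset.sum_mul, ← TensorProduct.tmul_sum, ← map_sum, sum_counit_smul]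

variable (K) in
/-- The endomorphism `x ↦ ∑ x₁ φ(x₂)` of `A` attached to a functional `φ`; it is the transpose of
right convolution by `φ` on the dual of `A`. -/
noncomputable def rightConv : Dual K A →ₗ[K] (A →ₗ[K] A) where
  toFun φ := (TensorProduct.rid K A).toLinearMap ∘ₗ φ.lTensor A ∘ₗ comul (R := K)
  map_add' φ ψ := by ext; simp [LinearMap.lTensor_add]
  map_smul' r φ := by ext; simp [LinearMap.lTensor_smul]

theorem rid_lTensor_mul (φ : Dual K A) (a : A) (z : A ⊗[K] A) :
    TensorProduct.rid K A (φ.lTensor A ((a ⊗ₜ[K] (1 : A)) * z)) =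
      a * TensorProduct.rid K A (φ.lTensor A z) := by
  induction z with
  | zero => simp
  | tmul x y => simp
  | add x y hx hy => simp only [mul_add, map_add, hx, hy]

theorem rid_lTensor_mul_right (φ : Dual K A) (a : A) (z : A ⊗[K] A) :
    TensorProduct.rid K A (φ.lTensor A (((1 : A) ⊗ₜ[K] a) * z)) =
      TensorProduct.rid K A ((φ ∘ₗ LinearMap.mulLeft K a).lTensor A z) := by
  induction z with
  | zero => simp
  | tmul x y => simp
  | add x y hx hy => simp only [mul_add, map_add, hx, hy]

/-- The functional `φ ↦ tr (rightConv φ)` on the dual of `A` is invariant. The reason is the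
identity `rightConv (φ (a ·)) = ∑ S(a₁) · rightConv φ (a₂ ·)`, in which the two multiplications
recombine to `∑ S(a₁) a₂ = ε(a)` under the trace. -/
theorem trace_rightConv_comp_mulLeft [FiniteDimensional K A] (φ : Dual K A) (a : A) :
    LinearMap.trace K A (rightConv K (φ ∘ₗ LinearMap.mulLeft K a)) =
      counit (R := K) a * LinearMap.trace K A (rightConv K φ) := by
  let r := ℛ K a
  have h1 : rightConv K (φ ∘ₗ LinearMap.mulLeft K a) =
      ∑ i ∈ r.index, LinearMap.mulLeft K (antipode K (r.left i)) ∘ₗ rightConv K φ ∘ₗ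
        LinearMap.mulLeft K (r.right i) := by
    ext x
    have : ((1 : A) ⊗ₜ[K] a) * comul (R := K) x =
        ∑ i ∈ r.index, ((antipode K (r.left i)) ⊗ₜ[K] (1 : A)) *
          comul (R := K) (r.right i * x) := by
      rw [← one_tmul_eq_map_comul, ← r.eq]
      simp [Finset.sum_mul, mul_assoc]
    have h2 := rid_lTensor_mul_right φ a (comul (R := K) x)
    rw [this] at h2
    simp only [map_sum, rid_lTensor_mul] at h2
    simpa [rightConv] using h2.symm
  have h3 : ∀ i, LinearMap.trace K A (LinearMap.mulLeft K (antipode K (r.left i)) ∘ₗ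
      rightConv K φ ∘ₗ LinearMap.mulLeft K (r.right i)) = LinearMap.trace K A (rightConv K φ ∘ₗ
        LinearMap.mulLeft K (antipode K (r.left i) * r.right i)) := by
    intro i
    rw [LinearMap.trace_comp_comm', LinearMap.comp_assoc, mul_comm, LinearMap.mulLeft_mul]
  rw [h1, map_sum]
  simp_rw [h3]
  have h4 : ∑ i ∈ r.index, rightConv K φ ∘ₗ
      LinearMap.mulLeft K (antipode K (r.left i) * r.right i) =
        counit (R := K) a • rightConv K φ := by
    ext x
    simp only [LinearMap.sum_apply, LinearMap.comp_apply, LinearMap.mulLeft_apply, ← map_sum,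
      ← Finset.sum_mul, sum_antipode_mul_eq_smul r, smul_mul_assoc, one_mul, map_smul,
      LinearMap.smul_apply]
  rw [← map_sum, h4, map_smul, smul_eq_mul]

variable (K A) in
/-- A finite-dimensional commutative Hopf algebra has an integral `c` representing the functional
`φ ↦ tr (rightConv φ)` on the dual. The point of this choice is that `ε(c)` is the dimension, hence
nonzero in characteristic zero. -/
theorem exists_integral [FiniteDimensional K A] : ∃ c : A,
    (∀ φ : Dual K A, φ c = LinearMap.trace K A (rightConv K φ)) ∧
    (∀ x : A, x * c = counit (R := K) x • c) ∧ counit (R := K) c = finrank K A := by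
  obtain ⟨c, hc⟩ := (Module.evalEquiv K A).surjective (LinearMap.trace K A ∘ₗ rightConv K)
  have hc' : ∀ φ : Dual K A, φ c = LinearMap.trace K A (rightConv K φ) := fun φ ↦
    LinearMap.congr_fun hc φ
  refine ⟨c, hc', fun x ↦ ?_, ?_⟩
  · refine (Module.forall_dual_apply_eq_zero_iff K _).1 (fun φ ↦ ?_) |> sub_eq_zero.1
    rw [map_sub, sub_eq_zero, map_smul, hc', smul_eq_mul, ← trace_rightConv_comp_mulLeft, ← hc']
    simp
  · rw [hc']
    have : rightConv K (counit (R := K) (A := A)) = LinearMap.id := by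
      ext x; simp [rightConv]
    rw [this, LinearMap.trace_id]

/-- The trace form is itself an integral on `A`, i.e. `∑ x₁ tr(x₂) = tr(x)`. -/
theorem lTensor_trace_comul [FiniteDimensional K A] (x : A) :
    TensorProduct.rid K A ((Algebra.trace K A).lTensor A (comul (R := K) x)) =
      algebraMap K A (Algebra.trace K A x) := by
  -- the trace of the `A`-algebra `A ⊗ A` is the base change of the trace of `A`
  have tr_tmul : ∀ z : A ⊗[K] A, Algebra.trace A (A ⊗[K] A) z =
      TensorProduct.rid K A ((Algebra.trace K A).lTensor A z) := by
    intro z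
    induction z with
    | zero => simp
    | add x y hx hy => simp only [map_add, hx, hy]
    | tmul a b =>
      have h1 : a ⊗ₜ[K] b = a • ((1 : A) ⊗ₜ[K] b) := by simp [TensorProduct.smul_tmul']
      have h2 : LinearMap.mulLeft A ((1 : A) ⊗ₜ[K] b) = (LinearMap.mulLeft K b).baseChange A := by
        ext; simp
      rw [h1, map_smul, Algebra.trace_apply]
      change a • LinearMap.trace _ _ (LinearMap.mulLeft A ((1 : A) ⊗ₜ[K] b)) = _
      rw [h2, LinearMap.trace_baseChange, ← h1]
      simp [Algebra.trace_apply, Algebra.smul_def, mul_comm]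
      rfl
  -- `a ⊗ b ↦ (a ⊗ 1) Δ(b)` is an `A`-algebra automorphism of `A ⊗ A`, and so preserves the trace
  let f : A ⊗[K] A →ₐ[A] A ⊗[K] A := Algebra.TensorProduct.lift (Algebra.ofId A _)
    (Bialgebra.comulAlgHom K A) (fun _ _ ↦ Commute.all _ _)
  let g : A ⊗[K] A →ₐ[A] A ⊗[K] A := Algebra.TensorProduct.lift (Algebra.ofId A _)
    ((Algebra.TensorProduct.map (antipodeAlgHom K A) (AlgHom.id K A)).comp
      (Bialgebra.comulAlgHom K A)) (fun _ _ ↦ Commute.all _ _)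
  have hf : ∀ a b : A, f (a ⊗ₜ b) = (a ⊗ₜ[K] (1 : A)) * comul (R := K) b := fun a b ↦ by
    simp [f, Algebra.ofId_apply]
  have hfg : ∀ z, f (g z) = z := by
    suffices f.comp g = AlgHom.id A _ from fun z ↦ DFunLike.congr_fun this z
    ext b
    have h : ∀ z : A ⊗[K] A, f (Algebra.TensorProduct.map (antipodeAlgHom K A) (AlgHom.id K A) z) =
        LinearMap.mul' K (A ⊗[K] A) (TensorProduct.map
          ((TensorProduct.mk K A A).flip 1 ∘ₗ antipode K) (comul (R := K)) z) := by
      intro z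
      induction z with
      | zero => simp
      | add x y hx hy => simp only [map_add, hx, hy]
      | tmul a b => exact hf _ _
    have h' := h (comul (R := K) b)
    rw [one_tmul_eq_map_comul] at h'
    simpa [g, Algebra.ofId_apply, ← Algebra.TensorProduct.one_def] using h'
  have hbij : Function.Bijective f :=
    have hs : Function.Surjective f := fun z ↦ ⟨g z, hfg z⟩
    ⟨OrzechProperty.injective_of_surjective_endomorphism f.toLinearMap hs, hs⟩
  have h1 := Algebra.trace_eq_of_algEquiv (AlgEquiv.ofBijective f hbij) ((1 : A) ⊗ₜ[K] x)
  rw [AlgEquiv.coe_ofBijective, hf, tr_tmul, tr_tmul] at h1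
  simpa [← Algebra.TensorProduct.one_def, Algebra.smul_def] using h1

theorem trace_integral [FiniteDimensional K A] {c : A}
    (hc : ∀ x : A, x * c = counit (R := K) x • c) :
    Algebra.trace K A c = counit (R := K) c := by
  have h : LinearMap.mulLeft K c = (LinearMap.toSpanSingleton K A c) ∘ₗ counit (R := K) := by
    ext x; simp [mul_comm c x, hc]
  rw [Algebra.trace_apply]
  change LinearMap.trace K A (LinearMap.mulLeft K c) = _
  rw [h, LinearMap.trace_comp_comm']
  have : counit (R := K) ∘ₗ LinearMap.toSpanSingleton K A c =
      counit (R := K) c • LinearMap.id := by ext; simp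
  rw [this, map_smul, LinearMap.trace_id]; simp

/-- With `n` the dimension of `A` and `c` an integral such that `ε(c) = n`, every `a` is recovered
from the functional `tr(S(a) ·)` through `n a = ∑ c₁ tr(S(a) c₂)`. -/
theorem finrank_smul_eq [FiniteDimensional K A] {c : A}
    (hc : ∀ x : A, x * c = counit (R := K) x • c) (hc' : counit (R := K) c = finrank K A) (a : A) :
    (finrank K A : K) • a = TensorProduct.rid K A
      ((Algebra.trace K A ∘ₗ LinearMap.mulLeft K (antipode K a)).lTensor A (comul (R := K) c)) := by
  rw [← rid_lTensor_mul_right, ← tmul_mul_comul_of_integral hc, rid_lTensor_mul,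
    lTensor_trace_comul, trace_integral hc, hc', Algebra.smul_def, mul_comm]

variable [FiniteDimensional K A] [CharZero K]

theorem finrank_ne_zero : (finrank K A : K) ≠ 0 := by
  have : Nontrivial A := by
    refine ⟨1, 0, fun h ↦ ?_⟩
    have := congr(counit (R := K) $h)
    simp at this
  exact_mod_cast (finrank_pos (R := K) (M := A)).ne'

theorem antipode_surjective : Function.Surjective (antipode K (A := A)) := by
  obtain ⟨c, -, hc, hc'⟩ := exists_integral K A
  refine LinearMap.injective_iff_surjective.1 ((injective_iff_map_eq_zero _).2 fun a ha ↦ ?_)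
  have := finrank_smul_eq hc hc' a
  rw [ha, LinearMap.mulLeft_zero_eq_zero] at this
  exact (smul_eq_zero.1 (this.trans (by simp))).resolve_left finrank_ne_zero

/-- In characteristic zero the trace form of a finite-dimensional commutative Hopf algebra is
nondegenerate. -/
theorem eq_zero_of_trace_mul_eq_zero {a : A} (ha : ∀ b, Algebra.trace K A (a * b) = 0) :
    a = 0 := by
  obtain ⟨c, -, hc, hc'⟩ := exists_integral K A
  obtain ⟨a, rfl⟩ := antipode_surjective (K := K) a
  have h : Algebra.trace K A ∘ₗ LinearMap.mulLeft K (antipode K a) = 0 := by ext b; simp [ha]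
  have := finrank_smul_eq hc hc' a
  rw [h] at this
  rw [(smul_eq_zero.1 (this.trans (by simp))).resolve_left finrank_ne_zero, map_zero]

variable [IsCocomm K A]

/-- In characteristic zero the trace form of the convolution algebra dual to a finite-dimensional
commutative and cocommutative Hopf algebra is nondegenerate. -/
theorem eq_zero_of_trace_convMul_eq_zero {φ : WithConv (A →ₗ[K] K)}
    (hφ : ∀ ψ, Algebra.trace K (WithConv (A →ₗ[K] K)) (φ * ψ) = 0) : φ = 0 := by
  obtain ⟨c, hc₀, hc, hc'⟩ := exists_integral K A
  -- the integral `c` represents the trace of the dual algebra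
  have htr : ∀ φ : WithConv (A →ₗ[K] K),
      Algebra.trace K (WithConv (A →ₗ[K] K)) φ = φ.ofConv c := by
    intro φ
    rw [hc₀, ← LinearMap.trace_transpose', Algebra.trace_apply,
      ← LinearMap.trace_conj' _ (WithConv.linearEquiv K (A →ₗ[K] K))]
    congr 1
    ext ψ x
    have h : ∀ z : A ⊗[K] A, LinearMap.mul' K K (TensorProduct.map ψ φ.ofConv z) =
        ψ (TensorProduct.rid K A (φ.ofConv.lTensor A z)) := by
      intro z
      induction z with
      | zero => simp
      | add x y hx hy => simp only [map_add, hx, hy]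
      | tmul a b => simp [mul_comm]
    change (φ * WithConv.toConv ψ) x = _
    rw [mul_comm φ]
    exact h _
  have h : TensorProduct.lid K A (φ.ofConv.rTensor A (comul (R := K) c)) = 0 := by
    refine (Module.forall_dual_apply_eq_zero_iff K _).1 fun ψ ↦ ?_
    have h : ∀ z : A ⊗[K] A, ψ (TensorProduct.lid K A (φ.ofConv.rTensor A z)) =
        LinearMap.mul' K K (TensorProduct.map φ.ofConv ψ z) := by
      intro z
      induction z with
      | zero => simp
      | add x y hx hy => simp only [map_add, hx, hy]
      | tmul a b => simp
    rw [h]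
    exact (htr _).symm.trans (hφ (WithConv.toConv ψ))
  ext a
  have h1 : ∀ (f : Dual K A) (z : A ⊗[K] A), φ.ofConv (TensorProduct.rid K A (f.lTensor A z)) =
      f (TensorProduct.lid K A (φ.ofConv.rTensor A z)) := by
    intro f z
    induction z with
    | zero => simp
    | add x y hx hy => simp only [map_add, hx, hy]
    | tmul a b => simp [mul_comm]
  have h2 := congr(φ.ofConv $(finrank_smul_eq hc hc' a))
  rw [h1, h, map_zero, map_smul] at h2
  exact (smul_eq_zero.1 h2).resolve_left finrank_ne_zero

end HopfAlgebra
end FieldHopf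

/-! ### Lattices over a Dedekind domain -/

section Lattice
open Module TensorProduct

variable {R K V : Type*} [CommRing R] [IsDedekindDomain R] [Field K] [Algebra R K]
  [IsFractionRing R K] [AddCommGroup V] [Module K V] [Module R V] [IsScalarTower R K V]

omit [IsFractionRing R K] in
/-- A submodule of a vector space is finitely generated if finitely many functionals separating the
points of the space are integral on it: it embeds into a finite power of `R`. -/
theorem Submodule.fg_of_integral_functionals {ι : Type*} [Finite ι] (f : ι → Dual K V)
    (hf : ∀ x, (∀ i, f i x = 0) → x = 0) (N : Submodule R V)
    (hN : ∀ x ∈ N, ∀ i, f i x ∈ (algebraMap R K).range) : N.FG := by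
  let g : N →ₗ[R] ι → (1 : Submodule R K) :=
    LinearMap.pi fun i ↦ (((f i).restrictScalars R).comp N.subtype).codRestrict _ fun x ↦ by
      simpa [Submodule.mem_one] using hN x x.2 i
  have hg : Function.Injective g := by
    refine (injective_iff_map_eq_zero g).2 fun x hx ↦ Subtype.ext (hf _ fun i ↦ ?_)
    exact congr((($hx) i : K))
  have : IsNoetherian R (1 : Submodule R K) :=
    isNoetherian_of_fg_of_noetherian _
      (by rw [Submodule.one_eq_span]; exact Submodule.fg_span_singleton _)
  have := isNoetherian_of_injective g hg
  exact Module.Finite.iff_fg.1 inferInstance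

variable (K) in
/-- The functionals on a vector space that take values in `R` on the submodule `L`. -/
def Submodule.dualLattice (L : Submodule R V) : Submodule R (Dual K V) where
  carrier := {φ | ∀ x ∈ L, φ x ∈ (algebraMap R K).range}
  add_mem' hφ hψ x hx := add_mem (hφ x hx) (hψ x hx)
  zero_mem' x hx := zero_mem _
  smul_mem' r φ hφ x hx := by
    rw [LinearMap.smul_apply, Algebra.smul_def]
    exact mul_mem ⟨r, rfl⟩ (hφ x hx)

namespace Submodule.IsLattice

theorem exists_smul_mem (L : Submodule R V) [IsLattice K L] (x : V) :
    ∃ r : R, r ≠ 0 ∧ r • x ∈ L := by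
  have hx : x ∈ Submodule.span K (L : Set V) := by rw [IsLattice.span_eq_top]; trivial
  induction hx using Submodule.span_induction with
  | mem x hx => exact ⟨1, one_ne_zero, by simpa using hx⟩
  | zero => exact ⟨1, one_ne_zero, by simp⟩
  | add x y _ _ hx hy =>
    obtain ⟨r, hr, hrx⟩ := hx
    obtain ⟨s, hs, hsy⟩ := hy
    refine ⟨r * s, mul_ne_zero hr hs, ?_⟩
    rw [smul_add]
    refine L.add_mem ?_ ?_
    · rw [mul_comm, mul_smul]; exact L.smul_mem _ hrx
    · rw [mul_smul]; exact L.smul_mem _ hsy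
  | smul k x _ hx =>
    obtain ⟨r, hr, hrx⟩ := hx
    obtain ⟨a, b, hb, rfl⟩ := IsFractionRing.div_surjective (A := R) k
    refine ⟨b * r, mul_ne_zero (nonZeroDivisors.ne_zero hb) hr, ?_⟩
    have hb' : algebraMap R K b ≠ 0 := IsFractionRing.to_map_ne_zero_of_mem_nonZeroDivisors hb
    have : (b * r) • (algebraMap R K a / algebraMap R K b) • x = a • r • x := by
      rw [← IsScalarTower.algebraMap_smul K (b * r), ← IsScalarTower.algebraMap_smul K a,
        ← IsScalarTower.algebraMap_smul K r, smul_smul, smul_smul, map_mul]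
      congr 1
      field_simp
    rw [this]
    exact L.smul_mem _ hrx

theorem isBaseChange_subtype (L : Submodule R V) [IsLattice K L] : IsBaseChange K L.subtype := by
  have : IsLocalizedModule (nonZeroDivisors R) L.subtype :=
    { map_units := fun r ↦ by
        rw [Module.End.isUnit_iff]
        have hr : algebraMap R K r ≠ 0 :=
          IsFractionRing.to_map_ne_zero_of_mem_nonZeroDivisors r.2
        have h : ∀ x : V, (r : R) • x = algebraMap R K r • x := fun x ↦
          (IsScalarTower.algebraMap_smul K (r : R) x).symm
        refine ⟨fun x y hxy ↦ ?_, fun x ↦ ⟨(algebraMap R K r)⁻¹ • x, ?_⟩⟩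
        · exact smul_right_injective V hr ((h x).symm.trans (hxy.trans (h y)))
        · exact (h _).trans (smul_inv_smul₀ hr x)
      surj := fun x ↦ by
        obtain ⟨r, hr, h⟩ := exists_smul_mem (K := K) L x
        exact ⟨⟨⟨_, h⟩, ⟨r, mem_nonZeroDivisors_of_ne_zero hr⟩⟩, rfl⟩
      exists_of_eq := fun {x y} h ↦ ⟨1, by simpa using h⟩ }
  exact IsLocalizedModule.isBaseChange (nonZeroDivisors R) K L.subtype

/-- A lattice, being a projective module, has a finite dual basis. -/
theorem exists_dual_basis (L : Submodule R V) [IsLattice K L] :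
    ∃ (n : ℕ) (c : Fin n → V) (φ : Fin n → Dual K V), (∀ i, c i ∈ L) ∧
      (∀ i, φ i ∈ L.dualLattice K) ∧ ∀ x, ∑ i, φ i x • c i = x := by
  have : IsTorsionFree R K := inferInstance
  have : IsTorsionFree R V := .trans K
  have : Module.FinitePresentation R L := Module.finitePresentation_of_finite R L
  have : Module.Projective R L := Module.Flat.projective_of_finitePresentation
  obtain ⟨n, p, s, -, -, hs⟩ := Module.Finite.exists_comp_eq_id_of_projective R L
  have hb := isBaseChange_subtype (K := K) L
  let φ : Fin n → Dual K V := fun i ↦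
    hb.lift (Algebra.linearMap R K ∘ₗ LinearMap.proj i ∘ₗ s)
  have hφ : ∀ i (x : L), φ i x = algebraMap R K (s x i) := fun i x ↦ hb.lift_eq _ x
  refine ⟨n, fun i ↦ p (Pi.single i 1), φ, fun i ↦ Subtype.coe_prop _,
    fun i x hx ↦ ⟨_, (hφ i ⟨x, hx⟩).symm⟩, fun x ↦ ?_⟩
  have key : ∑ i, (φ i).smulRight (p (Pi.single i 1) : V) = LinearMap.id := by
    refine hb.algHom_ext _ _ fun x ↦ ?_
    have := congr(((($hs) x : L) : V))
    rw [LinearMap.comp_apply, ← (Pi.basisFun R (Fin n)).sum_repr (s x)] at this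
    simpa [hφ] using this
  simpa using LinearMap.congr_fun key x

variable [FiniteDimensional K V]

omit [IsDedekindDomain R] [IsFractionRing R K] in
theorem exists_basis_mem (L : Submodule R V) [IsLattice K L] :
    ∃ (n : ℕ) (b : Basis (Fin n) K V), ∀ i, b i ∈ L := by
  obtain ⟨s, hs, hspan, hli⟩ := exists_linearIndependent K (L : Set V)
  let b : Basis s K V := Basis.mk hli (by
    rw [Subtype.range_coe, hspan, IsLattice.span_eq_top])
  have := Module.Finite.finite_basis b
  have := Fintype.ofFinite s
  exact ⟨_, b.reindex (Fintype.equivFin s), fun i ↦ by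
    simpa [b] using hs ((Fintype.equivFin s).symm i).2⟩

instance dualLattice (L : Submodule R V) [IsLattice K L] : IsLattice K (L.dualLattice K) where
  fg := by
    obtain ⟨n, b, hb⟩ := exists_basis_mem (K := K) L
    refine Submodule.fg_of_integral_functionals (K := K) (fun i ↦ Dual.eval K V (b i))
      (fun φ hφ ↦ b.ext fun i ↦ by simpa using hφ i) _ fun φ hφ i ↦ hφ _ (hb i)
  span_eq_top := by
    obtain ⟨n, c, φ, hc, hφ, h⟩ := exists_dual_basis (K := K) L
    refine eq_top_iff.2 fun ψ _ ↦ ?_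
    have : ψ = ∑ i, ψ (c i) • φ i := by
      ext x
      conv_lhs => rw [← h x]
      simp [mul_comm]
    rw [this]
    exact Submodule.sum_mem _ fun i _ ↦ Submodule.smul_mem _ _ (Submodule.subset_span (hφ i))

omit [FiniteDimensional K V] in
theorem mem_iff_forall_dualLattice (L : Submodule R V) [IsLattice K L] {x : V} :
    x ∈ L ↔ ∀ φ ∈ L.dualLattice K, φ x ∈ (algebraMap R K).range := by
  refine ⟨fun hx φ hφ ↦ hφ x hx, fun h ↦ ?_⟩
  obtain ⟨n, c, φ, hc, hφ, hx⟩ := exists_dual_basis (K := K) L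
  rw [← hx x]
  refine L.sum_mem fun i _ ↦ ?_
  obtain ⟨r, hr⟩ := h _ (hφ i)
  rw [← hr, IsScalarTower.algebraMap_smul]
  exact L.smul_mem r (hc i)

omit [FiniteDimensional K V] in
theorem le_of_dualLattice_le (L L' : Submodule R V) [IsLattice K L] [IsLattice K L']
    (h : L.dualLattice K ≤ L'.dualLattice K) : L' ≤ L := fun _ hx ↦
  (mem_iff_forall_dualLattice (K := K) L).2 fun _ hφ ↦ h hφ _ hx

omit [Module R V] [IsScalarTower R K V] in
/-- A lattice of functionals is the dual of its own dual in `V`. -/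
theorem forall_dualLattice_dualLattice (M : Submodule R (Dual K V)) [IsLattice K M] {φ : Dual K V}
    (h : ∀ x, (∀ ψ ∈ M, ψ x ∈ (algebraMap R K).range) → φ x ∈ (algebraMap R K).range) :
    φ ∈ M := by
  refine (mem_iff_forall_dualLattice (K := K) M).2 fun e he ↦ ?_
  obtain ⟨x, rfl⟩ := (Module.evalEquiv K V).surjective e
  exact h x he

theorem trace_mem (L : Submodule R V) [IsLattice K L] (T : V →ₗ[K] V) (hT : ∀ x ∈ L, T x ∈ L) :
    LinearMap.trace K V T ∈ (algebraMap R K).range := by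
  obtain ⟨n, c, φ, hc, hφ, h⟩ := exists_dual_basis (K := K) L
  have hT' : T = ∑ i, LinearMap.toSpanSingleton K V (T (c i)) ∘ₗ φ i := by
    ext x
    conv_lhs => rw [← h x]
    simp
  rw [hT', map_sum]
  refine sum_mem fun i _ ↦ ?_
  rw [LinearMap.trace_comp_comm']
  have : φ i ∘ₗ LinearMap.toSpanSingleton K V (T (c i)) = φ i (T (c i)) • LinearMap.id := by
    ext; simp
  rw [this, map_smul, LinearMap.trace_id]
  simpa using hφ i _ (hT _ (hc i))

/-- A nonempty directed family of multiplicatively closed lattices in an algebra with nondegenerate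
trace form has a greatest element: all its members lie in the trace dual of one of them, which is a
Noetherian module. -/
theorem exists_greatest_order {E : Type*} [CommRing E] [Algebra K E] [Module R E]
    [IsScalarTower R K E] [FiniteDimensional K E]
    (hE : ∀ x : E, (∀ y, Algebra.trace K E (x * y) = 0) → x = 0)
    {S : Set (Submodule R E)} (hne : S.Nonempty) (hlat : ∀ L ∈ S, IsLattice K L)
    (hmul : ∀ L ∈ S, ∀ x ∈ L, ∀ y ∈ L, x * y ∈ L) (hdir : DirectedOn (· ≤ ·) S) :
    ∃ L, IsGreatest S L := by
  obtain ⟨L₀, hL₀⟩ := hne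
  have := hlat L₀ hL₀
  obtain ⟨n, b, hb⟩ := exists_basis_mem (K := K) L₀
  -- the trace dual of the span of a basis contained in a member of the family
  let N : Submodule R E :=
    { carrier := {x | ∀ i, Algebra.trace K E (x * b i) ∈ (algebraMap R K).range}
      add_mem' := fun hx hy i ↦ by rw [add_mul, map_add]; exact add_mem (hx i) (hy i)
      zero_mem' := fun i ↦ by simp
      smul_mem' := fun r x hx i ↦ by
        rw [← IsScalarTower.algebraMap_smul K r x, smul_mul_assoc, map_smul, smul_eq_mul]
        exact mul_mem ⟨r, rfl⟩ (hx i) }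
  have hN : N.FG := Submodule.fg_of_integral_functionals (K := K)
    (fun i ↦ Algebra.trace K E ∘ₗ LinearMap.mulRight K (b i))
    (fun x hx ↦ hE x fun y ↦ by
      have : Algebra.trace K E ∘ₗ LinearMap.mulLeft K x = 0 := b.ext fun i ↦ by simpa using hx i
      exact LinearMap.congr_fun this y) N fun x hx i ↦ hx i
  have hle : ∀ L ∈ S, L ≤ N := fun L hL x hx i ↦ by
    obtain ⟨L₁, hL₁, h, h₀⟩ := hdir L hL L₀ hL₀
    have := hlat L₁ hL₁
    exact trace_mem (K := K) L₁ _ fun y hy ↦ hmul L₁ hL₁ _ (hmul L₁ hL₁ _ (h hx) _ (h₀ (hb i))) _ hy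
  have : IsNoetherian R N := isNoetherian_of_fg_of_noetherian _ hN
  obtain ⟨_, ⟨L, hL, rfl⟩, hmax⟩ := (inferInstance : WellFoundedGT (Submodule R N)).wf.has_min
    ((fun L ↦ L.comap N.subtype) '' S) ⟨_, _, hL₀, rfl⟩
  refine ⟨L, hL, fun L' hL' ↦ ?_⟩
  obtain ⟨L₁, hL₁, h, h'⟩ := hdir L hL L' hL'
  have h2 : L₁.comap N.subtype = L.comap N.subtype := by
    by_contra hne
    exact hmax _ ⟨L₁, hL₁, rfl⟩ (lt_of_le_of_ne (Submodule.comap_mono h) (Ne.symm hne))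
  intro x hx
  have : (⟨x, hle L' hL' hx⟩ : N) ∈ L₁.comap N.subtype := h' hx
  rw [h2] at this
  exact this

end Submodule.IsLattice
end Lattice

/-! ### Hopf orders -/

section AntipodeHom
open Coalgebra HopfAlgebra TensorProduct WithConv

theorem BialgHom.map_antipode {K A B : Type*} [CommSemiring K] [Semiring A] [Semiring B]
    [HopfAlgebra K A] [HopfAlgebra K B] (h : B →ₐc[K] A) (x : B) :
    h (antipode K x) = antipode K (h x) := by
  have h1 : toConv (antipode K (A := A) ∘ₗ (h : B →ₗc[K] A).toLinearMap) *
      toConv (h : B →ₗc[K] A).toLinearMap = 1 := by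
    have := LinearMap.convMul_comp_coalgHom_distrib (toConv (antipode K (A := A)))
      (toConv LinearMap.id) (h : B →ₗc[K] A)
    rw [LinearMap.antipode_mul_id] at this
    ext x
    have h2 := congr($this x).symm
    refine h2.trans ?_
    simp
  have h2 : toConv (h : B →ₗc[K] A).toLinearMap *
      toConv ((h : B →ₗc[K] A).toLinearMap ∘ₗ antipode K) = 1 := by
    have := LinearMap.algHom_comp_convMul_distrib (h : B →ₐ[K] A) (toConv LinearMap.id)
      (toConv (antipode K (A := B)))
    rw [LinearMap.id_mul_antipode] at this
    ext x
    have h2 := congr($this x).symm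
    refine h2.trans ?_
    exact AlgHomClass.commutes (h : B →ₐ[K] A) _
  exact congr(($(left_inv_eq_right_inv h1 h2)).ofConv x).symm

theorem HopfAlgebra.comul_antipode {K A : Type*} [CommSemiring K] [CommSemiring A]
    [HopfAlgebra K A] [IsCocomm K A] (x : A) : comul (R := K) (antipode K x) =
      TensorProduct.map (antipode K) (antipode K) (comul (R := K) x) :=
  BialgHom.map_antipode (Bialgebra.comulBialgHom K A) x
end AntipodeHom

namespace Submodule.IsLattice
variable {R K V W : Type*} [CommRing R] [Field K] [Algebra R K]
  [AddCommGroup V] [Module K V] [Module R V] [IsScalarTower R K V]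
  [AddCommGroup W] [Module K W] [Module R W] [IsScalarTower R K W]

theorem comap_equiv (e : V ≃ₗ[K] W) (L : Submodule R W) [IsLattice K L] :
    IsLattice K (L.comap (e.toLinearMap.restrictScalars R)) := by
  have h : L.comap (e.toLinearMap.restrictScalars R) =
      L.map (e.symm.toLinearMap.restrictScalars R) := by
    ext x
    simp only [Submodule.mem_comap, Submodule.mem_map]
    exact ⟨fun h ↦ ⟨_, h, by simp⟩, by rintro ⟨y, hy, rfl⟩; simpa using hy⟩
  rw [h]
  refine ⟨IsLattice.fg.map _, ?_⟩
  have := Submodule.span_image e.symm.toLinearMap (s := (L : Set W))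
  rw [IsLattice.span_eq_top, Submodule.map_top, LinearEquiv.range] at this
  exact this

end Submodule.IsLattice

section Order
open Module TensorProduct Coalgebra HopfAlgebra WithConv

variable {R K A : Type*} [CommRing R] [Field K] [Algebra R K]
  [CommRing A] [HopfAlgebra K A] [Algebra R A] [IsScalarTower R K A]

variable (K) in
/-- The image of `C ⊗[R] D` in `A ⊗[K] A`, as the subalgebra generated by `C ⊗ 1` and `1 ⊗ D`. -/
noncomputable def Subalgebra.tensorImage (C D : Subalgebra R A) : Subalgebra R (A ⊗[K] A) :=
  C.map ((Algebra.TensorProduct.includeLeft : A →ₐ[K] A ⊗[K] A).restrictScalars R) ⊔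
    D.map ((Algebra.TensorProduct.includeRight : A →ₐ[K] A ⊗[K] A).restrictScalars R)

namespace Subalgebra

theorem tensorImage_mono {C C' D D' : Subalgebra R A} (h : C ≤ C') (h' : D ≤ D') :
    C.tensorImage K D ≤ C'.tensorImage K D' :=
  sup_le_sup (Subalgebra.map_mono h) (Subalgebra.map_mono h')

theorem tmul_mem_tensorImage {C D : Subalgebra R A} {x y : A} (hx : x ∈ C) (hy : y ∈ D) :
    x ⊗ₜ[K] y ∈ C.tensorImage K D := by
  have : x ⊗ₜ[K] y = (x ⊗ₜ[K] 1) * (1 ⊗ₜ[K] y) := by simp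
  rw [this]
  exact mul_mem (le_sup_left (a := C.map _) ⟨x, hx, rfl⟩) (le_sup_right (b := D.map _) ⟨y, hy, rfl⟩)

theorem tensorImage_induction {C D : Subalgebra R A} {p : A ⊗[K] A → Prop}
    (tmul : ∀ x ∈ C, ∀ y ∈ D, p (x ⊗ₜ y)) (add : ∀ x y, p x → p y → p (x + y))
    {t : A ⊗[K] A} (ht : t ∈ C.tensorImage K D) : p t := by
  rw [← Subalgebra.mem_toSubmodule, tensorImage, ← Subalgebra.mul_toSubmodule] at ht
  refine Submodule.mul_induction_on ht ?_ add
  rintro _ ⟨x, hx, rfl⟩ _ ⟨y, hy, rfl⟩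
  simpa using tmul x hx y hy

/-- An `R`-subalgebra `C` of a Hopf algebra `A` over the fraction field `K` of `R` is a Hopf order
if it is a lattice stable under the structure maps: `Δ(C)` lies in the image of `C ⊗[R] C`, `ε(C)`
lies in `R` and `S(C)` lies in `C`. -/
structure IsHopfOrder (K : Type*) {A : Type*} [Field K] [Algebra R K]
    [CommRing A] [HopfAlgebra K A] [Algebra R A] [IsScalarTower R K A]
    (C : Subalgebra R A) : Prop where
  isLattice : Submodule.IsLattice K C.toSubmodule
  comul_mem : ∀ x ∈ C, comul (R := K) x ∈ C.tensorImage K C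
  counit_mem : ∀ x ∈ C, counit (R := K) x ∈ (algebraMap R K).range
  antipode_mem : ∀ x ∈ C, antipode K x ∈ C

variable [IsDedekindDomain R] [IsFractionRing R K]

/-- Membership in the image of `C ⊗[R] D` is tested by the tensor products of integral functionals.
-/
theorem mem_tensorImage_iff {C D : Subalgebra R A} [Submodule.IsLattice K C.toSubmodule]
    [Submodule.IsLattice K D.toSubmodule] {t : A ⊗[K] A} : t ∈ C.tensorImage K D ↔
      ∀ φ ∈ C.toSubmodule.dualLattice K, ∀ ψ ∈ D.toSubmodule.dualLattice K,
        LinearMap.mul' K K (TensorProduct.map φ ψ t) ∈ (algebraMap R K).range := by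
  constructor
  · intro ht φ hφ ψ hψ
    refine tensorImage_induction
      (p := fun t ↦ LinearMap.mul' K K (TensorProduct.map φ ψ t) ∈ (algebraMap R K).range)
      (fun x hx y hy ↦ ?_) (fun x y hx hy ↦ ?_) ht
    · simpa using mul_mem (hφ x hx) (hψ y hy)
    · simpa using add_mem hx hy
  · intro h
    obtain ⟨n, c, φ, hc, hφ, h₁⟩ := Submodule.IsLattice.exists_dual_basis (K := K) C.toSubmodule
    obtain ⟨m, d, ψ, hd, hψ, h₂⟩ := Submodule.IsLattice.exists_dual_basis (K := K) D.toSubmodule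
    have ht : t = ∑ i, ∑ j, LinearMap.mul' K K (TensorProduct.map (φ i) (ψ j) t) •
        (c i ⊗ₜ[K] d j) := by
      clear h
      induction t with
      | zero => simp
      | add x y hx hy =>
        conv_lhs => rw [hx, hy]
        simp [add_smul, Finset.sum_add_distrib]
      | tmul x y =>
        conv_lhs => rw [← h₁ x, ← h₂ y]
        simp only [TensorProduct.sum_tmul, TensorProduct.tmul_sum, TensorProduct.map_tmul,
          LinearMap.mul'_apply, TensorProduct.smul_tmul_smul]
        exact Finset.sum_comm
    rw [ht]
    refine sum_mem fun i _ ↦ sum_mem fun j _ ↦ ?_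
    obtain ⟨r, hr⟩ := h _ (hφ i) _ (hψ j)
    rw [← hr, IsScalarTower.algebraMap_smul]
    exact Subalgebra.smul_mem _ (tmul_mem_tensorImage (hc i) (hd j)) r

end Subalgebra

namespace Subalgebra.IsHopfOrder

theorem sup {C D : Subalgebra R A} (hC : C.IsHopfOrder K) (hD : D.IsHopfOrder K) :
    (C ⊔ D).IsHopfOrder K where
  isLattice := by
    have := hC.isLattice
    have := hD.isLattice
    refine Submodule.IsLattice.of_le_of_isLattice_of_fg K (M := C.toSubmodule)
      (Subalgebra.toSubmodule.monotone le_sup_left) ?_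
    rw [← Subalgebra.mul_toSubmodule]
    exact Submodule.IsLattice.fg.mul Submodule.IsLattice.fg
  comul_mem := by
    change C ⊔ D ≤ ((C ⊔ D).tensorImage K (C ⊔ D)).comap
      ((Bialgebra.comulAlgHom K A).restrictScalars R)
    exact sup_le (fun x hx ↦ tensorImage_mono le_sup_left le_sup_left (hC.comul_mem x hx))
      (fun x hx ↦ tensorImage_mono le_sup_right le_sup_right (hD.comul_mem x hx))
  counit_mem := by
    change C ⊔ D ≤ (Algebra.ofId R K).range.comap
      ((Bialgebra.counitAlgHom K A).restrictScalars R)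
    exact sup_le hC.counit_mem hD.counit_mem
  antipode_mem := by
    change C ⊔ D ≤ (C ⊔ D).comap ((antipodeAlgHom K A).restrictScalars R)
    exact sup_le (fun x hx ↦ le_sup_left (a := C) (hC.antipode_mem x hx))
      (fun x hx ↦ le_sup_right (b := D) (hD.antipode_mem x hx))

variable [IsDedekindDomain R] [IsFractionRing R K] [FiniteDimensional K A] [IsCocomm K A]

instance : IsScalarTower R K (WithConv (A →ₗ[K] K)) :=
  ⟨fun r k φ ↦ WithConv.ext (smul_assoc r k φ.ofConv)⟩

variable (K) in
/-- The functionals integral on `L`, inside the convolution algebra dual to `A`. -/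
noncomputable def _root_.Submodule.convDual (L : Submodule R A) :
    Submodule R (WithConv (A →ₗ[K] K)) :=
  (L.dualLattice K).comap
    ((WithConv.linearEquiv K (A →ₗ[K] K)).toLinearMap.restrictScalars R)

instance (L : Submodule R A) [Submodule.IsLattice K L] : Submodule.IsLattice K (L.convDual K) :=
  Submodule.IsLattice.comap_equiv _ _

omit [FiniteDimensional K A] [IsCocomm K A] in
theorem convDual_mul_mem {C : Subalgebra R A} (hC : C.IsHopfOrder K)
    {φ ψ : WithConv (A →ₗ[K] K)} (hφ : φ ∈ C.toSubmodule.convDual K)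
    (hψ : ψ ∈ C.toSubmodule.convDual K) : φ * ψ ∈ C.toSubmodule.convDual K := fun x hx ↦
  have := hC.isLattice
  mem_tensorImage_iff.1 (hC.comul_mem x hx) φ.ofConv hφ ψ.ofConv hψ

omit [IsDedekindDomain R] [IsFractionRing R K] [FiniteDimensional K A] [IsCocomm K A] in
theorem one_mem_convDual {C : Subalgebra R A} (hC : C.IsHopfOrder K) :
    1 ∈ C.toSubmodule.convDual K := fun x hx ↦ hC.counit_mem x hx

/-- Two Hopf orders `C` and `D` have a common Hopf suborder, namely the preimage under `Δ` of the
image of `C ⊗[R] D`. It is dual to the product of the duals of `C` and `D`, which is closed under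
convolution because convolution is commutative. -/
theorem exists_inf {C D : Subalgebra R A} (hC : C.IsHopfOrder K) (hD : D.IsHopfOrder K) :
    ∃ I : Subalgebra R A, I.IsHopfOrder K ∧ I ≤ C ∧ I ≤ D := by
  have hCl := hC.isLattice
  have hDl := hD.isLattice
  let I : Subalgebra R A := (C.tensorImage K D).comap
    ((Bialgebra.comulAlgHom K A).restrictScalars R)
  let M : Submodule R (WithConv (A →ₗ[K] K)) :=
    C.toSubmodule.convDual K * D.toSubmodule.convDual K
  have mem_I : ∀ x, x ∈ I ↔ ∀ μ ∈ M, μ x ∈ (algebraMap R K).range := by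
    intro x
    refine (mem_tensorImage_iff (K := K) (C := C) (D := D)).trans
      ⟨fun h μ hμ ↦ ?_, fun h φ hφ ψ hψ ↦ ?_⟩
    · refine Submodule.mul_induction_on hμ (fun φ hφ ψ hψ ↦ h _ hφ _ hψ) fun φ ψ hφ hψ ↦ ?_
      exact add_mem hφ hψ
    · exact h _ (Submodule.mul_mem_mul (M := C.toSubmodule.convDual K) (m := toConv φ)
        (n := toConv ψ) hφ hψ)
  have hCM : C.toSubmodule.convDual K ≤ M := fun φ hφ ↦ by
    simpa using Submodule.mul_mem_mul hφ (one_mem_convDual hD)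
  have hDM : D.toSubmodule.convDual K ≤ M := fun φ hφ ↦ by
    simpa using Submodule.mul_mem_mul (one_mem_convDual hC) hφ
  have hM : Submodule.IsLattice K M :=
    Submodule.IsLattice.of_le_of_isLattice_of_fg K hCM
      (Submodule.IsLattice.fg.mul Submodule.IsLattice.fg)
  let M' : Submodule R (Dual K A) := M.comap
    ((WithConv.linearEquiv K (A →ₗ[K] K)).symm.toLinearMap.restrictScalars R)
  have hM' : Submodule.IsLattice K M' := Submodule.IsLattice.comap_equiv _ _
  have hI : I.toSubmodule = (M'.dualLattice K).comap
      ((Module.evalEquiv K A).toLinearMap.restrictScalars R) := by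
    ext x
    exact (mem_I x).trans ⟨fun h μ hμ ↦ h _ hμ, fun h μ hμ ↦ h μ.ofConv hμ⟩
  have hIl : Submodule.IsLattice K I.toSubmodule := by
    rw [hI]
    exact Submodule.IsLattice.comap_equiv _ _
  have hIM : ∀ φ ∈ I.toSubmodule.convDual K, φ ∈ M := fun φ hφ ↦
    Submodule.IsLattice.forall_dualLattice_dualLattice M' (φ := φ.ofConv) fun x hx ↦
      hφ x ((mem_I x).2 fun μ hμ ↦ hx μ.ofConv hμ)
  have hMM : ∀ φ ∈ M, ∀ ψ ∈ M, φ * ψ ∈ M := by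
    intro φ hφ ψ hψ
    refine Submodule.mul_induction_on hφ (fun a ha b hb ↦ ?_) fun x y hx hy ↦ ?_
    · refine Submodule.mul_induction_on hψ (fun c hc d hd ↦ ?_) fun x y hx hy ↦ ?_
      · rw [mul_mul_mul_comm]
        exact Submodule.mul_mem_mul (convDual_mul_mem hC ha hc) (convDual_mul_mem hD hb hd)
      · rw [mul_add]; exact add_mem hx hy
    · rw [add_mul]; exact add_mem hx hy
  have hIC : I ≤ C := fun x hx ↦ (Submodule.IsLattice.mem_iff_forall_dualLattice (K := K)
    C.toSubmodule).2 fun φ hφ ↦ (mem_I x).1 hx (toConv φ) (hCM hφ)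
  have hID : I ≤ D := fun x hx ↦ (Submodule.IsLattice.mem_iff_forall_dualLattice (K := K)
    D.toSubmodule).2 fun φ hφ ↦ (mem_I x).1 hx (toConv φ) (hDM hφ)
  refine ⟨I, ⟨hIl, fun x hx ↦ ?_, fun x hx ↦ hC.counit_mem x (hIC hx), fun x hx ↦ ?_⟩, hIC, hID⟩
  · exact mem_tensorImage_iff.2 fun φ hφ ψ hψ ↦
      (mem_I x).1 hx _ (hMM (toConv φ) (hIM _ hφ) (toConv ψ) (hIM _ hψ))
  · change comul (R := K) (antipode K x) ∈ C.tensorImage K D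
    rw [comul_antipode]
    refine tensorImage_induction
      (p := fun t ↦ TensorProduct.map (antipode K) (antipode K) t ∈ C.tensorImage K D)
      (fun x hx y hy ↦ ?_) (fun x y hx hy ↦ ?_) (show comul (R := K) x ∈ C.tensorImage K D from hx)
    · exact tmul_mem_tensorImage (hC.antipode_mem x hx) (hD.antipode_mem y hy)
    · rw [map_add]; exact add_mem hx hy

variable [CharZero K]

omit [IsCocomm K A] in
/-- Multiplicatively closed lattices in `A` are bounded by the trace form of `A`. -/
theorem exists_isGreatest (h : ∃ C : Subalgebra R A, C.IsHopfOrder K) :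
    ∃ C, IsGreatest {C : Subalgebra R A | C.IsHopfOrder K} C := by
  obtain ⟨C₀, hC₀⟩ := h
  obtain ⟨_, ⟨C, hC, rfl⟩, hmax⟩ := Submodule.IsLattice.exists_greatest_order (K := K) (R := R)
    (fun x hx ↦ eq_zero_of_trace_mul_eq_zero (K := K) (A := A) hx)
    (S := Subalgebra.toSubmodule '' {C : Subalgebra R A | C.IsHopfOrder K}) ⟨_, C₀, hC₀, rfl⟩
    (by rintro _ ⟨C, hC, rfl⟩; exact hC.isLattice)
    (by rintro _ ⟨C, hC, rfl⟩ x hx y hy; exact mul_mem (S := Subalgebra R A) hx hy)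
    (by
      rintro _ ⟨C, hC, rfl⟩ _ ⟨D, hD, rfl⟩
      exact ⟨_, ⟨C ⊔ D, hC.sup hD, rfl⟩, Subalgebra.toSubmodule.monotone le_sup_left,
        Subalgebra.toSubmodule.monotone le_sup_right⟩)
  exact ⟨C, hC, fun D hD ↦ hmax ⟨D, hD, rfl⟩⟩

/-- The duals of the Hopf orders are multiplicatively closed lattices in the convolution algebra,
so they are bounded by its trace form. -/
theorem exists_isLeast (h : ∃ C : Subalgebra R A, C.IsHopfOrder K) :
    ∃ C, IsLeast {C : Subalgebra R A | C.IsHopfOrder K} C := by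
  obtain ⟨C₀, hC₀⟩ := h
  have : FiniteDimensional K (WithConv (A →ₗ[K] K)) :=
    Module.Finite.equiv (WithConv.linearEquiv K (A →ₗ[K] K)).symm
  obtain ⟨_, ⟨C, hC, rfl⟩, hmax⟩ := Submodule.IsLattice.exists_greatest_order (K := K) (R := R)
    (fun x hx ↦ eq_zero_of_trace_convMul_eq_zero (K := K) (A := A) (φ := x) hx)
    (S := (fun C ↦ C.toSubmodule.convDual K) '' {C : Subalgebra R A | C.IsHopfOrder K})
    ⟨_, C₀, hC₀, rfl⟩
    (by rintro _ ⟨C, hC, rfl⟩; have := hC.isLattice; infer_instance)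
    (by rintro _ ⟨C, hC, rfl⟩ x hx y hy; exact convDual_mul_mem hC hx hy)
    (by
      rintro _ ⟨C, hC, rfl⟩ _ ⟨D, hD, rfl⟩
      obtain ⟨I, hI, hIC, hID⟩ := exists_inf hC hD
      exact ⟨_, ⟨I, hI, rfl⟩, fun φ hφ x hx ↦ hφ x (hIC hx), fun φ hφ x hx ↦ hφ x (hID hx)⟩)
  refine ⟨C, hC, fun D hD ↦ ?_⟩
  have := hC.isLattice
  have := hD.isLattice
  exact Submodule.IsLattice.le_of_dualLattice_le (K := K) D.toSubmodule C.toSubmodule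
    fun φ hφ ↦ hmax ⟨D, hD, rfl⟩ (show toConv φ ∈ _ from hφ)

end Subalgebra.IsHopfOrder
end Order

/-! ### The Hopf algebra structure of a Hopf order -/

section MapBaseChange
open TensorProduct

variable {R K A B C D : Type*} [CommRing R] [CommRing K] [Algebra R K]
  [CommRing A] [Algebra K A] [Algebra R A] [IsScalarTower R K A]
  [CommRing B] [Algebra K B] [Algebra R B] [IsScalarTower R K B]
  [CommRing C] [Algebra R C] [CommRing D] [Algebra R D]

namespace Algebra.TensorProduct

variable (K) in
/-- The map `C ⊗[R] D → A ⊗[K] B` induced by `R`-algebra maps `C → A` and `D → B`. -/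
noncomputable def mapOver (f : C →ₐ[R] A) (g : D →ₐ[R] B) : C ⊗[R] D →ₐ[R] A ⊗[K] B :=
  Algebra.TensorProduct.lift
    (((includeLeft : A →ₐ[K] A ⊗[K] B).restrictScalars R).comp f)
    (((includeRight : B →ₐ[K] A ⊗[K] B).restrictScalars R).comp g) fun _ _ ↦ Commute.all _ _

@[simp]
theorem mapOver_tmul (f : C →ₐ[R] A) (g : D →ₐ[R] B) (x : C) (y : D) :
    mapOver K f g (x ⊗ₜ y) = f x ⊗ₜ g y := by
  simp [mapOver]

theorem mapOver_injective {K : Type*} [Field K] [IsDedekindDomain R] [Algebra R K]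
    [IsFractionRing R K] [Algebra K A] [Algebra K B] [IsScalarTower R K A] [IsScalarTower R K B]
    {f : C →ₐ[R] A} {g : D →ₐ[R] B}
    (hf : Function.Injective f) (hg : Function.Injective g) :
    Function.Injective (mapOver K f g) := by
  have hA : Module.IsTorsionFree R A := .trans K
  have hB : Module.IsTorsionFree R B := .trans K
  have hC : Module.IsTorsionFree R C := hf.moduleIsTorsionFree f (map_smul f)
  have hD : Module.IsTorsionFree R D := hg.moduleIsTorsionFree g (map_smul g)
  have := IsLocalization.tensorProduct_compatibleSMul (nonZeroDivisors R) K A B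
  let e := TensorProduct.equivOfCompatibleSMul R K R A B
  have h : ∀ t, e (mapOver K f g t) = _root_.TensorProduct.map f.toLinearMap g.toLinearMap t := by
    intro t
    induction t with
    | zero => simp
    | add x y hx hy => rw [map_add, map_add, map_add, hx, hy]
    | tmul x y => rw [mapOver_tmul]; rfl
  refine Function.Injective.of_comp (f := e) ?_
  convert TensorProduct.map_injective_of_flat_flat' f.toLinearMap g.toLinearMap hf hg using 1
  exact funext h

theorem mapOver_map {C' D' : Type*} [CommRing C'] [Algebra R C'] [CommRing D'] [Algebra R D']
    (f : C →ₐ[R] A) (g : D →ₐ[R] B) (u : C' →ₐ[R] C) (v : D' →ₐ[R] D) (t : C' ⊗[R] D') :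
    mapOver K f g (map u v t) = mapOver K (f.comp u) (g.comp v) t := by
  induction t with
  | zero => simp
  | add x y hx hy => simp only [map_add, hx, hy]
  | tmul x y => simp

theorem map_mapOver {A' B' : Type*} [CommRing A'] [Algebra K A'] [Algebra R A']
    [IsScalarTower R K A'] [CommRing B'] [Algebra K B'] [Algebra R B'] [IsScalarTower R K B']
    (f : C →ₐ[R] A) (g : D →ₐ[R] B) (u : A →ₐ[K] A') (v : B →ₐ[K] B') (t : C ⊗[R] D) :
    map u v (mapOver K f g t) =
      mapOver K ((u.restrictScalars R).comp f) ((v.restrictScalars R).comp g) t := by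
  induction t with
  | zero => simp
  | add x y hx hy => simp only [map_add, hx, hy]
  | tmul x y => simp

theorem assoc_mapOver {E F : Type*} [CommRing E] [Algebra R E] [CommRing F] [Algebra K F]
    [Algebra R F] [IsScalarTower R K F] (f : C →ₐ[R] A) (g : D →ₐ[R] B) (h : E →ₐ[R] F)
    (t : (C ⊗[R] D) ⊗[R] E) :
    mapOver K f (mapOver K g h) (Algebra.TensorProduct.assoc R R R C D E t) =
      Algebra.TensorProduct.assoc K K K A B F (mapOver K (mapOver K f g) h t) := by
  induction t with
  | zero => simp
  | add x y hx hy => simp only [map_add, hx, hy]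
  | tmul x e =>
    induction x with
    | zero => simp
    | add x y hx hy => simp only [map_add, TensorProduct.add_tmul, hx, hy]
    | tmul x y => simp

end Algebra.TensorProduct
end MapBaseChange

section HopfOfOrder
open TensorProduct Coalgebra HopfAlgebra Algebra.TensorProduct

/-- An `R`-algebra map `j` from an `R`-bialgebra `C` to a `K`-bialgebra `A` is compatible with the
comultiplications and the counits. -/
structure Bialgebra.IsCompat {R : Type*} (K : Type*) {C A : Type*} [CommRing R]
    [CommRing K] [Algebra R K]
    [CommRing C] [Bialgebra R C] [CommRing A] [Bialgebra K A] [Algebra R A] [IsScalarTower R K A]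
    (j : C →ₐ[R] A) : Prop where
  comul_apply (x : C) : comul (R := K) (j x) = mapOver K j j (comul (R := R) x)
  counit_apply (x : C) : counit (R := K) (j x) = algebraMap R K (counit (R := R) x)

namespace Subalgebra
variable {R K A : Type*} [CommRing R] [IsDedekindDomain R] [Field K] [Algebra R K]
  [IsFractionRing R K] [CommRing A] [HopfAlgebra K A] [Algebra R A] [IsScalarTower R K A]

omit [IsDedekindDomain R] [IsFractionRing R K] in
theorem tensorImage_eq_range (C D : Subalgebra R A) :
    C.tensorImage K D = (mapOver K C.val D.val).range := by
  refine le_antisymm (sup_le ?_ ?_) ?_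
  · rintro _ ⟨x, hx, rfl⟩
    exact ⟨⟨x, hx⟩ ⊗ₜ 1, by simp⟩
  · rintro _ ⟨x, hx, rfl⟩
    exact ⟨1 ⊗ₜ ⟨x, hx⟩, by simp⟩
  · rintro _ ⟨t, rfl⟩
    induction t with
    | zero => simp
    | add x y hx hy => simpa using add_mem hx hy
    | tmul x y => simpa using tmul_mem_tensorImage x.2 y.2

/-- A Hopf order is the image of an `R`-Hopf algebra. The structure maps are the restrictions of
those of `A`, and the axioms hold because they hold in `A` and the tensor powers of the order embed
in those of `A`. -/
theorem IsHopfOrder.exists_hopfAlgebra {R K : Type*} {A : Type u} [CommRing R] [IsDedekindDomain R]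
    [Field K] [Algebra R K] [IsFractionRing R K] [CommRing A] [HopfAlgebra K A] [Algebra R A]
    [IsScalarTower R K A] {C : Subalgebra R A} (hC : C.IsHopfOrder K) :
    ∃ (C' : Type u) (_ : CommRing C') (_ : HopfAlgebra R C') (j : C' →ₐ[R] A),
      Bialgebra.IsCompat K j ∧ Function.Injective j ∧ j.range = C := by
  have hj : Function.Injective C.val := Subtype.val_injective
  have hjj : Function.Injective (mapOver K C.val C.val) := mapOver_injective hj hj
  have hjjj : Function.Injective (mapOver K C.val (mapOver K C.val C.val)) :=
    mapOver_injective hj hjj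
  have hK := IsFractionRing.injective R K
  let Δ : C →ₐ[R] C ⊗[R] C := (AlgEquiv.ofInjective _ hjj).symm.toAlgHom.comp
    ((((Bialgebra.comulAlgHom K A).restrictScalars R).comp C.val).codRestrict _ fun x ↦ by
      rw [← tensorImage_eq_range]; exact hC.comul_mem x x.2)
  let ε : C →ₐ[R] R := (AlgEquiv.ofInjective (Algebra.ofId R K) hK).symm.toAlgHom.comp
    ((((Bialgebra.counitAlgHom K A).restrictScalars R).comp C.val).codRestrict _ fun x ↦
      hC.counit_mem x x.2)
  let S : C →ₐ[R] C := (((antipodeAlgHom K A).restrictScalars R).comp C.val).codRestrict _ fun x ↦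
      hC.antipode_mem x x.2
  have hΔ (x) : mapOver K C.val C.val (Δ x) = comul (R := K) (x : A) :=
    congrArg Subtype.val (AlgEquiv.apply_symm_apply (AlgEquiv.ofInjective _ hjj) _)
  have hε (x) : algebraMap R K (ε x) = counit (R := K) (x : A) :=
    congrArg Subtype.val (AlgEquiv.apply_symm_apply (AlgEquiv.ofInjective (Algebra.ofId R K) hK) _)
  have hS (x) : (S x : A) = antipode K (x : A) := rfl
  have hΔ' : (mapOver K C.val C.val).comp Δ =
    ((Bialgebra.comulAlgHom K A).restrictScalars R).comp C.val := AlgHom.ext hΔ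
  have hε' : (Algebra.ofId R K).comp ε =
    ((Bialgebra.counitAlgHom K A).restrictScalars R).comp C.val := AlgHom.ext hε
  have hlid (t : R ⊗[R] C) : (Algebra.TensorProduct.lid R C t : A) =
    Algebra.TensorProduct.lid K A (mapOver K (Algebra.ofId R K) C.val t) := by
    induction t with
    | zero => simp
    | add x y hx hy => simp only [map_add, Subalgebra.coe_add, hx, hy]
    | tmul x y => simp [Algebra.ofId_apply]
  have hrid (t : C ⊗[R] R) : (Algebra.TensorProduct.rid R R C t : A) =
    Algebra.TensorProduct.rid K K A (mapOver K C.val (Algebra.ofId R K) t) := by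
    induction t with
    | zero => simp
    | add x y hx hy => simp only [map_add, Subalgebra.coe_add, hx, hy]
    | tmul x y => simp [Algebra.ofId_apply]
  have hid : C.val.comp (.id R C) = ((AlgHom.id K A).restrictScalars R).comp C.val := rfl
  let _ : Bialgebra R C := Bialgebra.ofAlgHom Δ ε
    (by
      ext x
      apply hjjj
      simp only [AlgHom.comp_apply]
      refine (assoc_mapOver (K := K) C.val C.val C.val _).trans ?_
      rw [mapOver_map, mapOver_map, hΔ', hid, ← map_mapOver, ← map_mapOver, hΔ]
      exact Coalgebra.coassoc_apply (R := K) (x : A))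
    (by
      ext x
      apply (Algebra.TensorProduct.lid R C).injective
      apply hj
      refine (hlid _).trans ?_
      simp only [AlgHom.comp_apply]
      rw [mapOver_map, hε', hid, ← map_mapOver, hΔ]
      exact (congr(TensorProduct.lid K A $(rTensor_counit_comul (R := K) (x : A)))).trans (by simp))
    (by
      ext x
      apply (Algebra.TensorProduct.rid R R C).injective
      apply hj
      refine (hrid _).trans ?_
      simp only [AlgHom.comp_apply]
      rw [mapOver_map, hε', hid, ← map_mapOver, hΔ]
      exact (congr(TensorProduct.rid K A $(lTensor_counit_comul (R := K) (x : A)))).trans (by simp))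
  have hl (f g : C →ₐ[R] C) (f' g' : A →ₐ[K] A) (hf : ∀ x, (f x : A) = f' x)
      (hg : ∀ x, (g x : A) = g' x) (t : C ⊗[R] C) :
      (Algebra.TensorProduct.lift f g (fun _ _ ↦ Commute.all _ _) t : A) =
        Algebra.TensorProduct.lift f' g' (fun _ _ ↦ Commute.all _ _) (mapOver K C.val C.val t) := by
    induction t with
    | zero => simp
    | add x y hx hy => simp only [map_add, Subalgebra.coe_add, hx, hy]
    | tmul x y => simp [hf, hg]
  let H : HopfAlgebra R C := HopfAlgebra.ofAlgHom S
    (by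
      ext x
      refine (hl S (.id R C) (antipodeAlgHom K A) (.id K A) hS (fun _ ↦ rfl) (Δ x)).trans ?_
      rw [hΔ]
      refine .trans ?_ ((mul_antipode_rTensor_comul_apply (R := K) (x : A)).trans ?_)
      · generalize comul (R := K) (x : A) = t
        induction t with
        | zero => simp
        | add x y hx hy => simp only [map_add, hx, hy]
        | tmul x y => simp
      · rw [← hε, ← IsScalarTower.algebraMap_apply]
        rfl)
    (by
      ext x
      refine (hl (.id R C) S (.id K A) (antipodeAlgHom K A) (fun _ ↦ rfl) hS (Δ x)).trans ?_
      rw [hΔ]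
      refine .trans ?_ ((mul_antipode_lTensor_comul_apply (R := K) (x : A)).trans ?_)
      · generalize comul (R := K) (x : A) = t
        induction t with
        | zero => simp
        | add x y hx hy => simp only [map_add, hx, hy]
        | tmul x y => simp
      · rw [← hε, ← IsScalarTower.algebraMap_apply]
        rfl)
  exact ⟨C, inferInstance, H, C.val, ⟨fun x ↦ (hΔ x).symm, fun x ↦ (hε x).symm⟩, hj, C.range_val⟩

end Subalgebra

theorem Bialgebra.comul_one_tmul {R K C : Type*} [CommRing R] [CommRing K] [Algebra R K]
    [CommRing C] [Bialgebra R C] (x : C) : comul (R := K) (1 ⊗ₜ[R] x : K ⊗[R] C) =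
      mapOver K (includeRight : C →ₐ[R] K ⊗[R] C) includeRight (comul (R := R) x) := by
  rw [← (ℛ R x).eq]
  simp [TensorProduct.comul_tmul, ← (ℛ R x).eq, TensorProduct.tmul_sum]

namespace Bialgebra.IsCompat
variable {R K C A : Type*} [CommRing R] [CommRing K] [Algebra R K]
  [CommRing C] [CommRing A] [Algebra R A]

theorem isCocomm [IsDedekindDomain R] {K : Type*} [Field K] [Algebra R K] [IsFractionRing R K]
    [Bialgebra R C] [Bialgebra K A] [IsScalarTower R K A] [IsCocomm K A] {j : C →ₐ[R] A}
    (hj : IsCompat K j) (hinj : Function.Injective j) : IsCocomm R C where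
  comm_comp_comul := by
    have h (t : C ⊗[R] C) : mapOver K j j (_root_.TensorProduct.comm R C C t) =
        _root_.TensorProduct.comm K A A (mapOver K j j t) := by
      induction t with
      | zero => simp
      | add x y hx hy => simp only [map_add, hx, hy]
      | tmul x y => simp
    ext x
    apply mapOver_injective (K := K) hinj hinj
    refine (h _).trans ?_
    rw [← hj.comul_apply, comm_comul]

/-- The map `K ⊗[R] C → A`, `k ⊗ x ↦ k • j x`, induced by a compatible map `j : C → A`. -/
noncomputable def baseChangeHom [Bialgebra R C] [Bialgebra K A] [IsScalarTower R K A]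
    {j : C →ₐ[R] A} (hj : IsCompat K j) : K ⊗[R] C →ₐc[K] A :=
  .ofAlgHom (Algebra.TensorProduct.lift (Algebra.ofId K A) j fun _ _ ↦ Commute.all _ _)
    (by
      apply Algebra.TensorProduct.ext'
      intro k x
      simp [hj.counit_apply, Algebra.smul_def, Algebra.ofId_apply, mul_comm])
    (by
      ext x
      have h : (((Algebra.TensorProduct.lift (Algebra.ofId K A) j fun _ _ ↦ Commute.all _ _ :
          K ⊗[R] C →ₐ[K] A).restrictScalars R).comp includeRight) = j := by ext; simp
      refine (congrArg (Algebra.TensorProduct.map _ _) (Bialgebra.comul_one_tmul x)).trans ?_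
      refine (map_mapOver _ _ _ _ _).trans ?_
      rw [h]
      exact (hj.comul_apply x).symm.trans (by simp))

theorem baseChangeHom_tmul [Bialgebra R C] [Bialgebra K A] [IsScalarTower R K A]
    {j : C →ₐ[R] A} (hj : IsCompat K j) (k : K) (x : C) : hj.baseChangeHom (k ⊗ₜ x) = k • j x := by
  change algebraMap K A k * j x = _
  rw [Algebra.smul_def]

theorem exists_bialgEquiv [Bialgebra R C] [Bialgebra K A] [IsScalarTower R K A]
    {j : C →ₐ[R] A} (hj : IsCompat K j) (h : IsBaseChange K j.toLinearMap) :
    ∃ e : A ≃ₐc[K] K ⊗[R] C, ∀ x, e (j x) = 1 ⊗ₜ x := by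
  refine ⟨(BialgEquiv.ofBijective hj.baseChangeHom ?_).symm, fun x ↦ ?_⟩
  · convert h.equiv.bijective using 1
    ext t
    induction t with
    | zero => simp
    | add x y hx hy => simp only [map_add, hx, hy]
    | tmul x y => rw [baseChangeHom_tmul, h.equiv_tmul]; rfl
  · rw [show j x = hj.baseChangeHom (1 ⊗ₜ x) by rw [baseChangeHom_tmul, one_smul]]
    exact BialgEquiv.symm_apply_apply _ _

end Bialgebra.IsCompat

namespace BialgEquiv
variable {R K C A : Type*} [CommRing R] [CommRing K] [Algebra R K]
  [CommRing C] [CommRing A] [Algebra R A] [Bialgebra R C] [Bialgebra K A] [IsScalarTower R K A]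
  (e : A ≃ₐc[K] K ⊗[R] C)

/-- The map `C → A`, `x ↦ e⁻¹(1 ⊗ x)`, attached to an identification of `A` with `K ⊗[R] C`. -/
noncomputable def fibreHom : C →ₐ[R] A :=
  ((e.symm : K ⊗[R] C →ₐ[K] A).restrictScalars R).comp Algebra.TensorProduct.includeRight

theorem fibreHom_apply (x : C) : e.fibreHom x = e.symm (1 ⊗ₜ x) := rfl

theorem isCompat_fibreHom : Bialgebra.IsCompat K e.fibreHom where
  comul_apply x := by
    rw [e.fibreHom_apply, ← CoalgHomClass.map_comp_comul_apply, Bialgebra.comul_one_tmul]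
    exact map_mapOver _ _ (e.symm : K ⊗[R] C →ₐ[K] A) (e.symm : K ⊗[R] C →ₐ[K] A) _
  counit_apply x := by
    rw [e.fibreHom_apply, CoalgHomClass.counit_comp_apply]
    simp [Algebra.algebraMap_eq_smul_one]

theorem isBaseChange_fibreHom : IsBaseChange K e.fibreHom.toLinearMap :=
  .of_equiv (e.symm : K ⊗[R] C ≃ₐ[K] A).toLinearEquiv fun _ ↦ rfl

theorem fibreHom_injective [Module.Flat R C] [FaithfulSMul R K] :
    Function.Injective e.fibreHom :=
  e.symm.injective.comp (Algebra.TensorProduct.includeRight_injective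
    (FaithfulSMul.algebraMap_injective R K))
end BialgEquiv

theorem BialgEquiv.isHopfOrder_range {R K C A : Type*} [CommRing R] [IsDedekindDomain R] [Field K]
    [Algebra R K] [IsFractionRing R K] [CommRing C] [CommRing A] [Algebra R A]
    [HopfAlgebra R C] [HopfAlgebra K A] [IsScalarTower R K A] [Module.Finite R C]
    (e : A ≃ₐc[K] K ⊗[R] C) : e.fibreHom.range.IsHopfOrder K where
  isLattice := by
    refine ⟨?_, ?_⟩
    · have : e.fibreHom.range.toSubmodule = (⊤ : Submodule R C).map e.fibreHom.toLinearMap := by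
        ext; simp
      rw [this]
      exact Module.Finite.fg_top.map _
    · refine Submodule.eq_top_iff'.2 fun x ↦ ?_
      refine e.isBaseChange_fibreHom.inductionOn x _ (zero_mem _) (fun c ↦ ?_)
        (fun k _ h ↦ Submodule.smul_mem _ k h) (fun _ _ ↦ add_mem)
      exact Submodule.subset_span ⟨c, rfl⟩
  comul_mem := by
    rintro _ ⟨x, rfl⟩
    refine (congrArg (· ∈ _) (e.isCompat_fibreHom.comul_apply x)).mpr ?_
    generalize comul (R := R) x = t
    induction t with
    | zero => simp
    | add x y hx hy => rw [map_add]; exact add_mem hx hy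
    | tmul x y =>
      rw [mapOver_tmul]
      exact Subalgebra.tmul_mem_tensorImage (e.fibreHom.mem_range_self x)
        (e.fibreHom.mem_range_self y)
  counit_mem := by
    rintro _ ⟨x, rfl⟩
    exact ⟨_, (e.isCompat_fibreHom.counit_apply x).symm⟩
  antipode_mem := by
    rintro _ ⟨x, rfl⟩
    refine ⟨antipode R x, ?_⟩
    refine Eq.trans ?_ (BialgHom.map_antipode (e.symm : K ⊗[R] C →ₐc[K] A) (1 ⊗ₜ x))
    rw [TensorProduct.antipode_def]
    simp [e.fibreHom_apply]

end HopfOfOrder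

/-! ### Affine group schemes and their base change -/

section AffineGroup
open MonoidalCategory Opposite TensorProduct Limits MonObj

/-- The affine group scheme over `Spec R` with coordinate ring the Hopf algebra `C`. -/
noncomputable abbrev hopfSpecObj (R : Type u) [CommRing R] (C : Type u) [CommRing C]
    [HopfAlgebra R C] : Grp (Over (Spec (.of R))) :=
  (hopfSpec (.of R)).obj (op (CommHopfAlgCat.of R C))

/-- The morphism of affine group schemes induced by a morphism of Hopf algebras. -/
noncomputable abbrev hopfSpecMap {R : Type u} [CommRing R] {C D : Type u} [CommRing C]
    [HopfAlgebra R C] [CommRing D] [HopfAlgebra R D] (f : C →ₐc[R] D) :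
    hopfSpecObj R D ⟶ hopfSpecObj R C :=
  (hopfSpec (.of R)).map (CommHopfAlgCat.ofHom f).op

section BaseChange
variable (R K : Type u) [CommRing R] [CommRing K] [Algebra R K]

/-- Base change of schemes along `Spec K ⟶ Spec R`. -/
noncomputable abbrev specPullback : Over (Spec (.of R)) ⥤ Over (Spec (.of K)) :=
  Over.pullback (Spec.map (CommRingCat.ofHom (algebraMap R K)))

variable (C : Type u) [CommRing C] [HopfAlgebra R C]

/-- The base change of the scheme `Spec C` to `K` is `Spec (K ⊗[R] C)`. -/
noncomputable def algSpecBaseChangeIso :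
    (specPullback R K).obj ((algSpec (.of R)).obj (op (CommAlgCat.of R C))) ≅
      (algSpec (.of K)).obj (op (CommAlgCat.of K (K ⊗[R] C))) :=
  (pullbackSymmetry .. ≪≫ pullbackSpecIso' R K C).asOver (Spec (.of K))

theorem isMonHom_algSpecBaseChangeIso :
    IsMonHom (M := ((specPullback R K).mapGrp.obj (hopfSpecObj R C)).X)
      (N := (hopfSpecObj K (K ⊗[R] C)).X) (algSpecBaseChangeIso R K C).hom :=
  inferInstanceAs (IsMonHom <|
    (pullbackSymmetry .. ≪≫ pullbackSpecIso' R K C).hom.asOver (Spec (.of K)))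

/-- The base change of the group scheme `Spec C` to `K` is `Spec (K ⊗[R] C)`. -/
noncomputable def hopfSpecBaseChangeIso :
    (specPullback R K).mapGrp.obj (hopfSpecObj R C) ≅ hopfSpecObj K (K ⊗[R] C) :=
  Grp.mkIso (algSpecBaseChangeIso R K C) (isMonHom_algSpecBaseChangeIso R K C).one_hom
    (isMonHom_algSpecBaseChangeIso R K C).mul_hom

variable {C} {D : Type u} [CommRing D] [HopfAlgebra R D]

theorem pullbackSpecIso_naturality (f : C →ₐ[R] D) (h) :
    pullback.lift (pullback.fst (Spec.map (CommRingCat.ofHom (algebraMap R D)))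
        (Spec.map (CommRingCat.ofHom (algebraMap R K))) ≫
          Spec.map (CommRingCat.ofHom f.toRingHom)) (pullback.snd _ _) h ≫
      (pullbackSymmetry (Spec.map (CommRingCat.ofHom (algebraMap R C)))
        (Spec.map (CommRingCat.ofHom (algebraMap R K))) ≪≫ pullbackSpecIso R K C).hom =
    (pullbackSymmetry _ _ ≪≫ pullbackSpecIso R K D).hom ≫
      Spec.map (CommRingCat.ofHom (Algebra.TensorProduct.map (.id K K) f).toRingHom) := by
  have h1 : (Algebra.TensorProduct.map (.id K K) f).toRingHom.comp
      Algebra.TensorProduct.includeLeftRingHom =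
        (Algebra.TensorProduct.includeLeftRingHom : K →+* K ⊗[R] D) := by ext; simp
  have h2 : (Algebra.TensorProduct.map (.id K K) f).toRingHom.comp
      (RingHomClass.toRingHom (Algebra.TensorProduct.includeRight : C →ₐ[R] K ⊗[R] C)) =
        (RingHomClass.toRingHom (Algebra.TensorProduct.includeRight : D →ₐ[R] K ⊗[R] D)).comp
          f.toRingHom := by ext; simp
  rw [← cancel_mono (pullbackSpecIso ..).inv,
    ← cancel_epi (pullbackSymmetry _ _ ≪≫ pullbackSpecIso R K D).inv]
  ext
  · simp only [Category.assoc, Iso.trans_hom, Iso.trans_inv, Iso.inv_hom_id_assoc, Iso.hom_inv_id,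
      Category.comp_id, pullbackSymmetry_hom_comp_fst, pullbackSymmetry_inv_comp_snd,
      pullbackSpecIso_inv_fst, pullback.lift_snd, ← Spec.map_comp, ← CommRingCat.ofHom_comp, h1]
  · simp only [Category.assoc, Iso.trans_hom, Iso.trans_inv, Iso.inv_hom_id_assoc, Iso.hom_inv_id,
      Category.comp_id, pullbackSymmetry_hom_comp_snd, pullbackSymmetry_inv_comp_fst_assoc,
      pullbackSpecIso_inv_snd_assoc, pullbackSpecIso_inv_snd, pullback.lift_fst,
      ← Spec.map_comp, ← CommRingCat.ofHom_comp, h2]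

theorem algSpecBaseChangeIso_naturality (f : C →ₐ[R] D) :
    (specPullback R K).map ((algSpec (.of R)).map (CommAlgCat.ofHom f).op) ≫
        (algSpecBaseChangeIso R K C).hom =
      (algSpecBaseChangeIso R K D).hom ≫
        (algSpec (.of K)).map (CommAlgCat.ofHom (Algebra.TensorProduct.map (.id K K) f)).op := by
  ext
  refine pullbackSpecIso_naturality R K f ?_

theorem hopfSpecBaseChangeIso_naturality (f : C →ₐc[R] D) :
    (specPullback R K).mapGrp.map (hopfSpecMap f) ≫ (hopfSpecBaseChangeIso R K C).hom =
      (hopfSpecBaseChangeIso R K D).hom ≫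
        hopfSpecMap (Bialgebra.TensorProduct.map (.id K K) f) := by
  apply Grp.hom_ext
  exact algSpecBaseChangeIso_naturality R K (f : C →ₐ[R] D)

end BaseChange

section HopfSpec
variable {R : Type u} [CommRing R]

variable {C D E : Type u} [CommRing C] [HopfAlgebra R C] [CommRing D] [HopfAlgebra R D]
  [CommRing E] [HopfAlgebra R E]

theorem hopfSpecMap_comp (f : C →ₐc[R] D) (g : D →ₐc[R] E) :
    hopfSpecMap (g.comp f) = hopfSpecMap g ≫ hopfSpecMap f :=
  (hopfSpec (.of R)).map_comp (CommHopfAlgCat.ofHom g).op (CommHopfAlgCat.ofHom f).op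

theorem hopfSpecMap_id : hopfSpecMap (.id R C) = 𝟙 (hopfSpecObj R C) :=
  (hopfSpec (.of R)).map_id _

theorem hopfSpecMap_injective : Function.Injective (hopfSpecMap (R := R) (C := C) (D := D)) := by
  intro f g h
  exact congrArg (fun h ↦ h.unop.hom) (hopfSpec.fullyFaithful.map_injective h)

theorem hopfSpecMap_surjective : Function.Surjective (hopfSpecMap (R := R) (C := C) (D := D)) := by
  intro f
  obtain ⟨g, hg⟩ := hopfSpec.fullyFaithful.map_surjective f
  exact ⟨g.unop.hom, hg⟩

/-- The isomorphism of group schemes induced by an isomorphism of Hopf algebras. -/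
noncomputable def hopfSpecIso (e : C ≃ₐc[R] D) : hopfSpecObj R D ≅ hopfSpecObj R C where
  hom := hopfSpecMap (e : C →ₐc[R] D)
  inv := hopfSpecMap (e.symm : D →ₐc[R] C)
  hom_inv_id := by rw [← hopfSpecMap_comp, BialgEquiv.comp_symm, hopfSpecMap_id]
  inv_hom_id := by rw [← hopfSpecMap_comp, BialgEquiv.symm_comp, hopfSpecMap_id]

theorem exists_hopfSpecIso_eq (i : hopfSpecObj R D ≅ hopfSpecObj R C) :
    ∃ e : C ≃ₐc[R] D, hopfSpecIso e = i := by
  obtain ⟨f, hf⟩ := hopfSpecMap_surjective i.hom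
  obtain ⟨g, hg⟩ := hopfSpecMap_surjective i.inv
  refine ⟨.ofBialgHom f g ?_ ?_, Iso.ext hf⟩ <;> apply hopfSpecMap_injective <;>
    rw [hopfSpecMap_comp, hf, hg] <;> simp

theorem exists_iso_hopfSpecObj (G : Grp (Over (Spec (.of R)))) (hG : IsAffine G.X.left) :
    ∃ (C : Type u) (_ : CommRing C) (_ : HopfAlgebra R C), Nonempty (hopfSpecObj R C ≅ G) := by
  obtain ⟨C, ⟨i⟩⟩ := (essImage_hopfSpec (G := G)).2 hG
  exact ⟨C.unop, inferInstance, C.unop.hopfAlgebra, ⟨i⟩⟩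

/-- The contravariant functor `Spec` on algebras reflects commutativity of monoid objects. -/
theorem isCommMonObj_of_algSpec {S : CommRingCat.{u}} (X : (CommAlgCat S)ᵒᵖ) [MonObj X]
    (h : IsCommMonObj ((algSpec S).mapMon.obj ⟨X⟩).X) : IsCommMonObj X where
  mul_comm := by
    refine (algSpec S).map_injective
      ((cancel_epi (Functor.LaxMonoidal.μ (algSpec S) X X)).1 ?_)
    rw [Functor.map_comp, ← Category.assoc]
    refine (congrArg (· ≫ (algSpec S).map μ[X])
      (Functor.LaxBraided.braided (F := algSpec S) X X)).trans ?_
    exact (Category.assoc ..).trans h.mul_comm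

theorem isCocomm_of_isCommMonObj (h : IsCommMonObj (hopfSpecObj R C).X) :
    Coalgebra.IsCocomm R C where
  comm_comp_comul := by
    have h' := (isCommMonObj_of_algSpec (S := .of R) (op (.of R C)) h).mul_comm
    ext x
    exact congr($(h').unop.hom x)

theorem hopfSpecObj_isFiniteFlat_iff {G : GroupScheme (Spec (.of R))}
    (e : hopfSpecObj R C ≅ G.toGrp) :
    G.IsFiniteFlat ↔ Module.Finite R C ∧ Module.Flat R C := by
  have h : G.X.hom = e.inv.hom.hom.left ≫ Spec.map (CommRingCat.ofHom (algebraMap R C)) :=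
    (Over.w e.inv.hom.hom).symm
  have h' : e.hom.hom.hom.left ≫ G.X.hom = Spec.map (CommRingCat.ofHom (algebraMap R C)) :=
    Over.w e.hom.hom.hom
  have : IsIso e.inv.hom.hom.left :=
    ((Over.forget _).mapIso ((Grp.forget _).mapIso e)).isIso_inv
  have : IsIso e.hom.hom.hom.left :=
    ((Over.forget _).mapIso ((Grp.forget _).mapIso e)).isIso_hom
  rw [← RingHom.finite_algebraMap, ← RingHom.flat_algebraMap_iff]
  constructor
  · rintro ⟨h₁, h₂⟩
    have h₃ : IsFinite (e.hom.hom.hom.left ≫ G.X.hom) := inferInstance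
    have h₄ : Flat (e.hom.hom.hom.left ≫ G.X.hom) := inferInstance
    rw [h'] at h₃ h₄
    exact ⟨(IsFinite.SpecMap_iff _).1 h₃, Flat.SpecMap_iff.1 h₄⟩
  · rintro ⟨h₁, h₂⟩
    have h₃ := (IsFinite.SpecMap_iff (CommRingCat.ofHom (algebraMap R C))).2 h₁
    have h₄ := (Flat.SpecMap_iff (f := CommRingCat.ofHom (algebraMap R C))).2 h₂
    exact ⟨h ▸ MorphismProperty.comp_mem _ _ _ inferInstance h₃,
      h ▸ MorphismProperty.comp_mem _ _ _ inferInstance h₄⟩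
end HopfSpec

end AffineGroup

/-! ### Prolongations and Hopf orders -/

section HopfMap
open TensorProduct

variable {R K A C D : Type*} [CommRing R] [CommRing K] [Algebra R K] [CommRing A] [CommRing C]
  [CommRing D] [HopfAlgebra R C] [HopfAlgebra R D] [HopfAlgebra K A] [Algebra R A]
  [IsScalarTower R K A]

theorem Bialgebra.TensorProduct.map_id_injective [Module.Flat R D] [FaithfulSMul R K]
    {g g' : C →ₐc[R] D} (h : Bialgebra.TensorProduct.map (.id K K) g =
      Bialgebra.TensorProduct.map (.id K K) g') : g = g' := by
  ext x
  apply Algebra.TensorProduct.includeRight_injective (B := D)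
    (FaithfulSMul.algebraMap_injective R K)
  exact congr($h (1 ⊗ₜ x))

/-- Let `C` and `D` be Hopf algebras over `R` whose base changes to `K` are identified with `A`.
The image of `C` in `A` is contained in that of `D` if and only if the identity of `A` extends to a
morphism of Hopf algebras from `C` to `D`. -/
theorem BialgEquiv.range_fibreHom_le_iff [IsDedekindDomain R] {K : Type*} [Field K] [Algebra R K]
    [IsFractionRing R K] [HopfAlgebra K A] [IsScalarTower R K A] [Module.Flat R D]
    (e : A ≃ₐc[K] K ⊗[R] C) (f : A ≃ₐc[K] K ⊗[R] D) : e.fibreHom.range ≤ f.fibreHom.range ↔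
      ∃ g : C →ₐc[R] D, (Bialgebra.TensorProduct.map (.id K K) g).comp (e : A →ₐc[K] K ⊗[R] C) =
        (f : A →ₐc[K] K ⊗[R] D) := by
  constructor
  · intro h
    have hf := f.fibreHom_injective
    let g : C →ₐ[R] D := (AlgEquiv.ofInjective _ hf).symm.toAlgHom.comp
      (e.fibreHom.codRestrict _ fun x ↦ h (e.fibreHom.mem_range_self x))
    have hg (x) : f.fibreHom (g x) = e.fibreHom x :=
      congrArg Subtype.val (AlgEquiv.apply_symm_apply (AlgEquiv.ofInjective _ hf) _)
    have hg' : f.fibreHom.comp g = e.fibreHom := AlgHom.ext hg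
    have hε : (Bialgebra.counitAlgHom R D).comp g = Bialgebra.counitAlgHom R C := by
      ext x
      apply IsFractionRing.injective R K
      refine (f.isCompat_fibreHom.counit_apply (g x)).symm.trans ?_
      rw [hg, e.isCompat_fibreHom.counit_apply]
      rfl
    have hΔ : (Algebra.TensorProduct.map g g).comp (Bialgebra.comulAlgHom R C) =
        (Bialgebra.comulAlgHom R D).comp g := by
      ext x
      apply Algebra.TensorProduct.mapOver_injective (K := K) hf hf
      refine (Algebra.TensorProduct.mapOver_map _ _ _ _ _).trans ?_
      rw [hg']
      refine (e.isCompat_fibreHom.comul_apply x).symm.trans ?_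
      rw [← hg, f.isCompat_fibreHom.comul_apply]
      rfl
    have h (t : K ⊗[R] C) :
        Bialgebra.TensorProduct.map (.id K K) (.ofAlgHom g hε hΔ) t = f (e.symm t) := by
      induction t with
      | zero => simp
      | add x y hx hy => simp only [map_add, hx, hy]
      | tmul k x =>
        have : k ⊗ₜ[R] x = k • (1 ⊗ₜ[R] x) := by simp [TensorProduct.smul_tmul']
        rw [this, map_smul, map_smul, map_smul, ← fibreHom_apply, ← hg, fibreHom_apply,
          f.apply_symm_apply]
        rfl
    refine ⟨.ofAlgHom g hε hΔ, ?_⟩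
    ext x
    refine (h (e x)).trans ?_
    rw [e.symm_apply_apply]
    rfl
  · rintro ⟨g, hg⟩ _ ⟨x, rfl⟩
    refine ⟨g x, f.injective ?_⟩
    refine .trans ?_ congr($hg (e.fibreHom x))
    rw [BialgHom.comp_apply]
    change f (f.symm (1 ⊗ₜ g x)) = Bialgebra.TensorProduct.map (.id K K) g (e (e.symm (1 ⊗ₜ x)))
    rw [f.apply_symm_apply, e.apply_symm_apply]
    rfl
end HopfMap

section Model
open TensorProduct

variable {R K : Type u} [CommRing R] [CommRing K] [Algebra R K] {G : GroupScheme (Spec (.of K))}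
  {A : Type u} [CommRing A] [HopfAlgebra K A]

/-- The identification of the generic fibre of a prolongation with `G`, as an isomorphism of group
objects. -/
noncomputable def Prolongation.grpIso (P : Prolongation R G) :
    (specPullback R K).mapGrp.obj P.obj.toGrp ≅ G.toGrp :=
  (CommGrp.forget₂Grp _).mapIso P.iso

/-- Suppose `G` is identified with the affine group scheme with coordinate ring `A`. A model of a
prolongation of `G` is a Hopf algebra `C` over `R` whose spectrum is identified with the
prolongation, together with the isomorphism of `A` with `K ⊗[R] C` that corresponds to the
identification of the generic fibres. -/
structure Prolongation.Model (e : hopfSpecObj K A ≅ G.toGrp) (P : Prolongation R G) where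
  /-- The coordinate ring. -/
  C : Type u
  [commRing : CommRing C]
  [hopfAlgebra : HopfAlgebra R C]
  [finite : Module.Finite R C]
  [flat : Module.Flat R C]
  /-- The identification of the prolongation with the spectrum of its coordinate ring. -/
  chart : hopfSpecObj R C ≅ P.obj.toGrp
  /-- The comparison of the coordinate rings of the generic fibres. -/
  fibre : A ≃ₐc[K] K ⊗[R] C
  comm : (specPullback R K).mapGrp.map chart.hom ≫ P.grpIso.hom =
    (hopfSpecBaseChangeIso R K C).hom ≫ hopfSpecMap (fibre : A →ₐc[K] K ⊗[R] C) ≫ e.hom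

namespace Prolongation.Model

attribute [instance] commRing hopfAlgebra finite flat

variable {e : hopfSpecObj K A ≅ G.toGrp}

theorem nonempty (e : hopfSpecObj K A ≅ G.toGrp) (P : Prolongation R G) :
    Nonempty (Model e P) := by
  have h := P.isFiniteFlat.finite
  obtain ⟨C, _, _, ⟨c⟩⟩ := exists_iso_hopfSpecObj P.obj.toGrp (isAffine_of_isAffineHom P.obj.X.hom)
  obtain ⟨h₁, h₂⟩ := (hopfSpecObj_isFiniteFlat_iff c).1 P.isFiniteFlat
  obtain ⟨κ, hκ⟩ := exists_hopfSpecIso_eq ((hopfSpecBaseChangeIso R K C).symm ≪≫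
    (specPullback R K).mapGrp.mapIso c ≪≫
    P.grpIso ≪≫ e.symm)
  refine ⟨⟨C, c, κ, ?_⟩⟩
  have hκ' : hopfSpecMap (κ : A →ₐc[K] K ⊗[R] C) = (hopfSpecBaseChangeIso R K C).inv ≫
    (specPullback R K).mapGrp.map c.hom ≫ P.grpIso.hom ≫ e.inv := congrArg Iso.hom hκ
  rw [hκ']
  simp

variable {P Q : Prolongation R G}

/-- Base change to `K` is faithful on finite flat group schemes. -/
theorem hom_ext [FaithfulSMul R K] (M : Model e P) (N : Model e Q) {f f' : P.obj ⟶ Q.obj}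
    (h : (GroupScheme.baseChange R K).map f = (GroupScheme.baseChange R K).map f') : f = f' := by
  obtain ⟨g, hg⟩ := hopfSpecMap_surjective (M.chart.hom ≫ f.hom ≫ N.chart.inv)
  obtain ⟨g', hg'⟩ := hopfSpecMap_surjective (M.chart.hom ≫ f'.hom ≫ N.chart.inv)
  have h' : (specPullback R K).mapGrp.map f.hom = (specPullback R K).mapGrp.map f'.hom :=
    congrArg (·.hom) h
  have hgg : g = g' := by
    refine Bialgebra.TensorProduct.map_id_injective (K := K) (hopfSpecMap_injective ?_)
    refine (cancel_epi (hopfSpecBaseChangeIso R K M.C).hom).1 ?_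
    refine (hopfSpecBaseChangeIso_naturality R K g).symm.trans
      (.trans ?_ (hopfSpecBaseChangeIso_naturality R K g'))
    simp only [hg, hg', Functor.map_comp, h']
  have h2 : f.hom = f'.hom := by
    rw [← cancel_epi M.chart.hom, ← cancel_mono N.chart.inv, Category.assoc, Category.assoc, ← hg,
      ← hg', hgg]
  exact InducedCategory.hom_ext h2

variable [Algebra R A] [IsScalarTower R K A]

/-- The Hopf order in `A` attached to a model: the image of the coordinate ring of the prolongation
in that of `G`. -/
noncomputable def order (M : Model e P) : Subalgebra R A := M.fibre.fibreHom.range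

/-- Morphisms of prolongations extending the identity of `G` amount to inclusions of Hopf orders. -/
theorem le_iff [IsDedekindDomain R] {K : Type u} [Field K] [Algebra R K] [IsFractionRing R K]
    {G : GroupScheme (Spec (.of K))} [HopfAlgebra K A] [IsScalarTower R K A]
    {e : hopfSpecObj K A ≅ G.toGrp} {P Q : Prolongation R G}
    (M : Model e P) (N : Model e Q) : P ≤ Q ↔ M.order ≤ N.order := by
  refine .trans ?_ (BialgEquiv.range_fibreHom_le_iff M.fibre N.fibre).symm
  -- `f` extends the identity if and only if the map of coordinate rings does
  have key (f : Q.obj ⟶ P.obj) (g : M.C →ₐc[R] N.C)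
      (hfg : N.chart.hom ≫ f.hom = hopfSpecMap g ≫ M.chart.hom) :
      Extends f (𝟙 G) ↔ (Bialgebra.TensorProduct.map (.id K K) g).comp
        (M.fibre : A →ₐc[K] K ⊗[R] M.C) = (N.fibre : A →ₐc[K] K ⊗[R] N.C) := by
    have h₁ : Extends f (𝟙 G) ↔
        (specPullback R K).mapGrp.map f.hom ≫ P.grpIso.hom = Q.grpIso.hom :=
      ⟨fun h ↦ (congrArg (·.hom) h).trans (Category.comp_id _), fun h ↦ InducedCategory.hom_ext
        (h.trans (Category.comp_id _).symm)⟩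
    have h₂ : (specPullback R K).mapGrp.map (N.chart.hom ≫ f.hom) ≫ P.grpIso.hom =
        (hopfSpecBaseChangeIso R K N.C).hom ≫
          hopfSpecMap ((Bialgebra.TensorProduct.map (.id K K) g).comp
            (M.fibre : A →ₐc[K] K ⊗[R] M.C)) ≫ e.hom := by
      rw [hfg, Functor.map_comp, Category.assoc, M.comm, hopfSpecMap_comp,
        ← Category.assoc, hopfSpecBaseChangeIso_naturality, Category.assoc, Category.assoc]
    rw [h₁, ← cancel_epi ((specPullback R K).mapGrp.map N.chart.hom), N.comm, ← Category.assoc,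
      ← Functor.map_comp, h₂, cancel_epi, cancel_mono, hopfSpecMap_injective.eq_iff]
  constructor
  · rintro ⟨f, hf⟩
    obtain ⟨g, hg⟩ := hopfSpecMap_surjective (N.chart.hom ≫ f.hom ≫ M.chart.inv)
    exact ⟨g, (key f g (by rw [hg]; simp)).1 hf⟩
  · rintro ⟨g, hg⟩
    exact ⟨InducedCategory.homMk (N.chart.inv ≫ hopfSpecMap g ≫ M.chart.hom),
      (key _ g (by simp)).2 hg⟩

end Prolongation.Model
end Model

section Dedekind
variable {R K : Type u} [CommRing R] [IsDedekindDomain R] [Field K] [Algebra R K]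
  [IsFractionRing R K] {G : GroupScheme (Spec (.of K))}
  {A : Type u} [CommRing A] [HopfAlgebra K A] [Algebra R A] [IsScalarTower R K A]
  {e : hopfSpecObj K A ≅ G.toGrp} {P : Prolongation R G}

namespace Prolongation.Model

theorem isHopfOrder_order (M : Model e P) : M.order.IsHopfOrder K := M.fibre.isHopfOrder_range

/-- Every Hopf order in the coordinate ring of `G` comes from a prolongation of `G`. -/
theorem exists_order_eq [Coalgebra.IsCocomm K A] (e : hopfSpecObj K A ≅ G.toGrp)
    {C : Subalgebra R A} (hC : C.IsHopfOrder K) :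
    ∃ (P : Prolongation R G) (M : Model e P), M.order = C := by
  obtain ⟨C', _, _, j, hj, hinj, rfl⟩ := hC.exists_hopfAlgebra
  have hl := hC.isLattice
  have hfin : Module.Finite R C' := by
    have : (⊤ : Submodule R C').map j.toLinearMap = j.range.toSubmodule := by ext; simp
    refine ⟨Submodule.fg_of_fg_map_injective j.toLinearMap hinj ?_⟩
    rw [this]
    exact hl.fg
  have htf : Module.IsTorsionFree R C' :=
    have : Module.IsTorsionFree R A := .trans K
    hinj.moduleIsTorsionFree j (map_smul j)
  have hbc : IsBaseChange K j.toLinearMap :=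
    (Submodule.IsLattice.isBaseChange_subtype j.range.toSubmodule).comp_equiv
      (AlgEquiv.ofInjective j hinj).toLinearEquiv _
  obtain ⟨κ, hκ⟩ := hj.exists_bialgEquiv hbc
  have hco : Coalgebra.IsCocomm R C' := hj.isCocomm hinj
  have hcomm : IsCommMonObj (hopfSpecObj R C').X :=
    isCommMonObj_spec_asOver_spec (R := .of R) (A := .of C')
  let H : GroupScheme (Spec (.of R)) := ⟨(hopfSpecObj R C').X⟩
  let P : Prolongation R G :=
    { obj := H
      isFiniteFlat :=
        (hopfSpecObj_isFiniteFlat_iff (G := H) (.refl _)).2 ⟨inferInstance, inferInstance⟩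
      iso := (CommGrp.fullyFaithfulForget₂Grp _).preimageIso
        (hopfSpecBaseChangeIso R K C' ≪≫ hopfSpecIso κ ≪≫ e) }
  refine ⟨P, ⟨C', .refl _, κ, ?_⟩, ?_⟩
  · refine (congrArg (· ≫ P.grpIso.hom)
      ((specPullback R K).mapGrp.map_id (hopfSpecObj R C'))).trans ?_
    exact Category.id_comp _
  · have : κ.fibreHom = j := by
      ext x
      rw [κ.fibreHom_apply, ← hκ, κ.symm_apply_apply]
    exact congrArg AlgHom.range this

end Prolongation.Model
end Dedekind

/-! ### Maximal and minimal prolongations -/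

section Final
open MonObj MonoidalCategory

theorem CategoryTheory.Grp.isCommMonObj_of_iso {V : Type*} [Category* V]
    [CartesianMonoidalCategory V] [BraidedCategory V] {X Y : Grp V} (e : X ≅ Y)
    (h : IsCommMonObj Y.X) : IsCommMonObj X.X where
  mul_comm := by
    have : IsIso e.hom.hom.hom := ((Grp.forget V).mapIso e).isIso_hom
    rw [← cancel_mono e.hom.hom.hom, Category.assoc, IsMonHom.mul_hom,
      ← BraidedCategory.braiding_naturality_assoc, h.mul_comm]

theorem GroupScheme.IsFiniteFlat.exists_hopfAlgebra {K : Type u} [Field K]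
    {G : GroupScheme (Spec (.of K))} (hG : G.IsFiniteFlat) :
    ∃ (A : Type u) (_ : CommRing A) (_ : HopfAlgebra K A), FiniteDimensional K A ∧
      Coalgebra.IsCocomm K A ∧ Nonempty (hopfSpecObj K A ≅ G.toGrp) := by
  have := hG.finite
  obtain ⟨A, _, _, ⟨e⟩⟩ := exists_iso_hopfSpecObj G.toGrp (isAffine_of_isAffineHom G.X.hom)
  exact ⟨A, _, _, ((hopfSpecObj_isFiniteFlat_iff e).1 hG).1,
    isCocomm_of_isCommMonObj (Grp.isCommMonObj_of_iso e G.comm), ⟨e⟩⟩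

namespace Prolongation
variable {R K : Type u} [CommRing R] [CommRing K] [Algebra R K] {G : GroupScheme (Spec (.of K))}

theorem Extends.comp {P Q T : Prolongation R G} {f : P.obj ⟶ Q.obj} {g : Q.obj ⟶ T.obj}
    {α β : G ⟶ G} (hf : Extends f α) (hg : Extends g β) : Extends (f ≫ g) (α ≫ β) := by
  simp only [Extends] at *
  rw [Functor.map_comp, Category.assoc, hg, reassoc_of% hf]

theorem extends_id (P : Prolongation R G) : Extends (𝟙 P.obj) (𝟙 G) := by simp [Extends]

/-- The prolongation with the same group scheme over `R` and with the identification of the generic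
fibre with `G` followed by `α`. -/
noncomputable def twist (P : Prolongation R G) (α : G ≅ G) : Prolongation R G :=
  ⟨P.obj, P.isFiniteFlat, P.iso ≪≫ α⟩

/-- For `P` maximal, the morphism to the twist of `P` by `α⁻¹` is an extension of `α`. -/
theorem exists_extends_of_isTop {P : Prolongation R G} (hP : IsTop P) (α : G ≅ G) :
    ∃ f : P.obj ⟶ P.obj, Extends f α.hom := by
  obtain ⟨f, hf⟩ : ∃ f : P.obj ⟶ P.obj, (GroupScheme.baseChange R K).map f ≫ P.iso.hom ≫ α.inv =
      P.iso.hom ≫ 𝟙 G := hP (P.twist α.symm)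
  refine ⟨f, ?_⟩
  change _ ≫ P.iso.hom = P.iso.hom ≫ α.hom
  rw [← cancel_mono α.inv]
  simpa using hf

/-- For `P` minimal, the morphism from the twist of `P` by `α` is an extension of `α`. -/
theorem exists_extends_of_isBot {P : Prolongation R G} (hP : IsBot P) (α : G ≅ G) :
    ∃ f : P.obj ⟶ P.obj, Extends f α.hom := by
  obtain ⟨f, hf⟩ : ∃ f : P.obj ⟶ P.obj, (GroupScheme.baseChange R K).map f ≫ P.iso.hom =
      (P.iso.hom ≫ α.hom) ≫ 𝟙 G := hP (P.twist α)
  exact ⟨f, hf.trans (Category.comp_id _)⟩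

variable [IsDedekindDomain R]

theorem Extends.ext {K : Type u} [Field K] [Algebra R K] [IsFractionRing R K]
    {G : GroupScheme (Spec (.of K))} (hG : G.IsFiniteFlat) {P Q : Prolongation R G}
    {f f' : P.obj ⟶ Q.obj} {α : G ⟶ G} (hf : Extends f α) (hf' : Extends f' α) : f = f' := by
  obtain ⟨A, _, _, _, _, ⟨e⟩⟩ := hG.exists_hopfAlgebra
  obtain ⟨M⟩ := Model.nonempty e P
  obtain ⟨N⟩ := Model.nonempty e Q
  exact M.hom_ext N ((cancel_mono Q.iso.hom).1 (hf.trans hf'.symm))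

variable {K : Type u} [Field K] [Algebra R K] [IsFractionRing R K] {G : GroupScheme (Spec (.of K))}

theorem exists_iso_extends (hG : G.IsFiniteFlat) {P Q : Prolongation R G} {α : G ≅ G}
    {f : P.obj ⟶ Q.obj} {g : Q.obj ⟶ P.obj} (hf : Extends f α.hom) (hg : Extends g α.inv) :
    ∃ e : P.obj ≅ Q.obj, Extends e.hom α.hom :=
  ⟨⟨f, g, (hf.comp hg).ext hG (by simpa using P.extends_id),
    (hg.comp hf).ext hG (by simpa using Q.extends_id)⟩, hf⟩

theorem exists_isTop_and_exists_isBot [CharZero K] (hG : G.IsFiniteFlat)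
    (hP : Nonempty (Prolongation R G)) :
    (∃ P : Prolongation R G, IsTop P) ∧ ∃ P : Prolongation R G, IsBot P := by
  obtain ⟨A, _, _, _, _, ⟨e⟩⟩ := hG.exists_hopfAlgebra
  let _ : Algebra R A := Algebra.compHom A (algebraMap R K)
  have : IsScalarTower R K A := .of_algebraMap_eq' rfl
  have h : ∃ C : Subalgebra R A, C.IsHopfOrder K :=
    hP.elim fun P ↦ (Model.nonempty e P).elim fun M ↦ ⟨_, M.isHopfOrder_order⟩
  constructor
  · obtain ⟨C, hC, hmax⟩ := Subalgebra.IsHopfOrder.exists_isGreatest h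
    obtain ⟨P, M, rfl⟩ := Model.exists_order_eq e hC
    refine ⟨P, fun Q ↦ ?_⟩
    obtain ⟨N⟩ := Model.nonempty e Q
    exact (N.le_iff M).2 (hmax N.isHopfOrder_order)
  · obtain ⟨C, hC, hmin⟩ := Subalgebra.IsHopfOrder.exists_isLeast h
    obtain ⟨P, M, rfl⟩ := Model.exists_order_eq e hC
    refine ⟨P, fun Q ↦ ?_⟩
    obtain ⟨N⟩ := Model.nonempty e Q
    exact (M.le_iff N).2 (hmin N.isHopfOrder_order)

end Prolongation
end Final

theorem mainTheorem9 {R K : Type u} [CommRing R] [IsDedekindDomain R] [Field K] [CharZero K]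
    [Algebra R K] [IsFractionRing R K]
    (G : GroupScheme (Spec (.of K))) (_hG : G.IsFiniteFlat)
    (_hP : Nonempty (Prolongation R G)) :
    -- the preorder is a partial order, up to isomorphisms extending the identity of `G`
    (∀ P Q : Prolongation R G, P ≤ Q → Q ≤ P →
      ∃ e : P.obj ≅ Q.obj, Prolongation.Extends e.hom (𝟙 G)) ∧
    -- a maximum and a minimum exist
    (∃ P : Prolongation R G, IsTop P) ∧
    (∃ P : Prolongation R G, IsBot P) ∧
    -- automorphisms of `G` extend to automorphisms of them, and the extension is unique, even
    -- among endomorphisms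
    (∀ P : Prolongation R G, IsTop P ∨ IsBot P → ∀ α : G ≅ G,
      ∃ e : P.obj ≅ P.obj, Prolongation.Extends e.hom α.hom ∧
        ∀ f : P.obj ⟶ P.obj, Prolongation.Extends f α.hom → f = e.hom) := by
  obtain ⟨htop, hbot⟩ := Prolongation.exists_isTop_and_exists_isBot _hG _hP
  refine ⟨fun P Q ⟨f, hf⟩ ⟨g, hg⟩ ↦
    Prolongation.exists_iso_extends (α := .refl G) _hG hg hf, htop, hbot, fun P hP α ↦ ?_⟩
  have h (β : G ≅ G) : ∃ f : P.obj ⟶ P.obj, Prolongation.Extends f β.hom :=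
    hP.elim (fun h ↦ Prolongation.exists_extends_of_isTop h β)
      fun h ↦ Prolongation.exists_extends_of_isBot h β
  obtain ⟨f, hf⟩ := h α
  obtain ⟨g, hg⟩ := h α.symm
  obtain ⟨e, he⟩ := Prolongation.exists_iso_extends _hG hf hg
  exact ⟨e, he, fun f' hf' ↦ hf'.ext _hG he⟩
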